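/- **Model.** The footprint is a finite simple undirected graph $G=(V,E)$ with $n=|V|$ anonymous nodes; the edges at each node $v$ carry local port numbers $0,\dots,\delta_v-1$ (the two port numbers of an edge are unrelated). In round $t=0,1,2,\dots$ only a connected spanning subgraph $G_t$ of $G$ with $|E\setminus E(G_t)|\le 1$ is present, chosen by an adversary. One node, the black hole, destroys without trace every agent that enters it; the other nodes are safe. Every node has a whiteboard, initially empty. Agents have distinct identifiers in $[1,n^c]$ for a constant $c$ unknown to them; an agent initially knows only its identifier, and all agents run the same deterministic algorithm, which does not depend on $G$, on $n$ or on $c$. In each synchronous round every agent that is alive and has not terminated (i) looks: it sees its memory, the identifiers and memories of the other agents at its node, the whiteboard and the degree (in $G$) of its node, and the outcome of its own last action (it did not try to move; it tried and the edge was missing; it moved and entered through port $q$); (ii) computes: it updates its memory and modifies the whiteboard of its node, the agents at a common node doing the latter one after another in an arbitrary order; (iii) acts: it stays, or tries to move through a port (successfully if and only if that edge is present in the round), or terminates, declaring a port of its node to lead to the black hole. Missing edges cannot be seen otherwise. **Theorem.** There are an algorithm for $9$ agents and a constant $K$, and for every $c$ a constant $M$, such that the following holds for every such footprint $G$, port numbering,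 black hole, safe start node at which all nine agents are placed, choice of identifiers in $[1,n^c]$, behaviour of the adversary and order of access to the whiteboards. 1. An agent that terminates is at a safe node, and the port that it declares does lead to the black hole. 2. After at most $K|E|^2$ rounds some agent has survived, has terminated and has declared a port of its node that leads to the black hole. 3. During these $K|E|^2$ rounds every agent stores at most $M\log_2 n$ bits (its identifier included), and every whiteboard holds at most $M\log_2 n$ bits. That is, nine agents starting from a rooted initial configuration solve $1$-BHS in $O(|E|^2)$ rounds with $O(\log n)$ bits of memory per agent and $O(\log n)$ bits of storage per node. -/

import Mathlib

namespace BHS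

/-- A port-labelled undirected simple graph: at every node `v` the incident edges carry the local
labels `0, …, δ_v - 1`, and `port v p` is the neighbour at the other end of port `p`.  The labels
at the two ends of an edge are unrelated. -/
structure PortGraph (V : Type*) where
  graph : SimpleGraph V
  port : ∀ v : V, Fin (Nat.card (graph.neighborSet v)) ≃ graph.neighborSet v

namespace PortGraph

variable {V : Type*}

/-- The degree of `v` in the footprint. -/
noncomputable def deg (P : PortGraph V) (v : V) : ℕ := Nat.card (P.graph.neighborSet v)

/-- The number of edges of the footprint. -/
noncomputable def numEdges (P : PortGraph V) : ℕ := P.graph.edgeSet.ncard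

/-- The edge behind port `p` of `v` exists in the footprint and leads to `w`. -/
def LeadsTo (P : PortGraph V) (v : V) (p : ℕ) (w : V) : Prop :=
  ∃ h : p < Nat.card (P.graph.neighborSet v), (P.port v ⟨p, h⟩ : V) = w

end PortGraph

/-- An admissible behaviour of the adversary: `H t` is the graph that is present in round `t`.  It
is connected and arises from the footprint `G` by the removal of at most `f` edges. -/
def Admissible {V : Type*} (G : SimpleGraph V) (f : ℕ) (H : ℕ → SimpleGraph V) : Prop :=
  ∀ t, H t ≤ G ∧ (H t).Connected ∧ (G.edgeSet \ (H t).edgeSet).encard ≤ f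

/-- What an agent perceives of its own move of the last round: it did not try to move, it tried
and the edge was missing, or it moved and entered its present node through the given port. -/
inductive LastMove where
  | stayed
  | blocked
  | arrived (port : ℕ)

/-- What an agent decides to do in the Move phase: stay, try to move through a port, or terminate
and declare that the given port of its present node leads to the black hole. -/
inductive Action where
  | stay
  | move (port : ℕ)
  | terminate (port : ℕ)

/-- All the information that an agent gets in the Look phase. -/
structure View where
  /-- its own identifier -/
  id : ℕ
  /-- its own memory -/
  mem : List Bool
  /-- the outcome of its own last move -/
  last : LastMove
  /-- the degree of its present node in the footprint -/
  deg : ℕ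
  /-- identifiers and memories of the other agents at its present node -/
  others : Finset (ℕ × List Bool)
  /-- the contents of the whiteboard of its present node -/
  board : List Bool

/-- The outcome of the Compute phase: the new memory, the modification of the whiteboard of the
present node (carried out in mutual exclusion with the other agents there), and the action. -/
structure Decision where
  mem : List Bool
  edit : List Bool → List Bool
  act : Action

/-- A deterministic algorithm, common to all agents and independent of the graph.  An agent
initially has nothing but its identifier. -/
structure Algorithm where
  init : ℕ → List Bool
  compute : View → Decision

/-- A configuration of `k` agents at the beginning of a round; `claim i = some p` says that agent
`i` has terminated, declaring that port `p` of its node leads to the black hole. -/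
structure Config (V : Type*) (k : ℕ) where
  mem : Fin k → List Bool
  pos : Fin k → V
  last : Fin k → LastMove
  claim : Fin k → Option ℕ
  board : V → List Bool

/-- An instance: the port-labelled footprint, the black hole, the node where all agents start, the
graphs present in the rounds, the identifiers of the agents, and for every round the order in which
agents at a common node get access to its whiteboard. -/
structure Instance (V : Type*) (k : ℕ) where
  ports : PortGraph V
  bh : V
  root : V
  present : ℕ → SimpleGraph V
  id : Fin k → ℕ
  order : ℕ → Equiv.Perm (Fin k)

/-- The rooted instances of `f`-BHS on a node set `V` with `k` agents whose identifiers are distinct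
and lie in `[1, n ^ c]`. -/
structure Instance.Valid {V : Type*} [Fintype V] {k : ℕ} (I : Instance V k) (f c : ℕ) : Prop where
  root_safe : I.root ≠ I.bh
  admissible : Admissible I.ports.graph f I.present
  id_injective : Function.Injective I.id
  id_range : ∀ i, 1 ≤ I.id i ∧ I.id i ≤ Fintype.card V ^ c

section Dynamics

variable {V : Type*} {k : ℕ}

/-- Agent `i` is alive, that is, it has not entered the black hole. -/
def Alive (I : Instance V k) (C : Config V k) (i : Fin k) : Prop := C.pos i ≠ I.bh

/-- Agent `i` still acts: it is alive and has not terminated. -/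
def Active (I : Instance V k) (C : Config V k) (i : Fin k) : Prop :=
  Alive I C i ∧ C.claim i = none

open Classical in
/-- What agent `i` sees in the Look phase. -/
noncomputable def view (I : Instance V k) (C : Config V k) (i : Fin k) : View where
  id := I.id i
  mem := C.mem i
  last := C.last i
  deg := I.ports.deg (C.pos i)
  others := (Finset.univ.filter fun j => j ≠ i ∧ C.pos j = C.pos i).image
    fun j => (I.id j, C.mem j)
  board := C.board (C.pos i)

open Classical in
/-- The attempt to leave `v` through port `p` while the graph `H` is present: the new position and
the perceived outcome.  On success the agent learns the port through which it enters. -/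
noncomputable def traverse (P : PortGraph V) (H : SimpleGraph V) (v : V) (p : ℕ) : V × LastMove :=
  if h : p < Nat.card (P.graph.neighborSet v) then
    if H.Adj v (P.port v ⟨p, h⟩) then
      ((P.port v ⟨p, h⟩ : V),
        LastMove.arrived
          ((P.port (P.port v ⟨p, h⟩)).symm ⟨v, (P.port v ⟨p, h⟩).2.symm⟩ : Fin _))
    else (v, LastMove.blocked)
  else (v, LastMove.blocked)

/-- The new position and the perceived outcome of an agent at `v` that performs an action. -/
noncomputable def perform (P : PortGraph V) (H : SimpleGraph V) (v : V) : Action → V × LastMove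
  | Action.stay => (v, LastMove.stayed)
  | Action.move p => traverse P H v p
  | Action.terminate _ => (v, LastMove.stayed)

/-- The port declared by an action. -/
def Action.declared : Action → Option ℕ
  | Action.stay => none
  | Action.move _ => none
  | Action.terminate p => some p

/-- What agent `i` computes in the present round. -/
noncomputable def decision (A : Algorithm) (I : Instance V k) (C : Config V k) (i : Fin k) :
    Decision :=
  A.compute (view I C i)

open Classical in
/-- One synchronous round (round number `t`): all active agents look, then compute and modify the
whiteboards of their nodes one after another in the order `I.order t`, then move.  Destroyed and
terminated agents do nothing. -/
noncomputable def step (A : Algorithm) (I : Instance V k) (t : ℕ) (C : Config V k) :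
    Config V k where
  mem i := if Active I C i then (decision A I C i).mem else C.mem i
  pos i := if Active I C i then
    (perform I.ports (I.present t) (C.pos i) (decision A I C i).act).1 else C.pos i
  last i := if Active I C i then
    (perform I.ports (I.present t) (C.pos i) (decision A I C i).act).2 else C.last i
  claim i := if Active I C i then (decision A I C i).act.declared else C.claim i
  board v := (List.ofFn (I.order t)).foldl
    (fun b i => if Active I C i ∧ C.pos i = v then (decision A I C i).edit b else b) (C.board v)

/-- The configuration at the beginning of round `t`, that is, after `t` rounds.  Initially all
agents are at the root and all whiteboards are empty. -/
noncomputable def run (A : Algorithm) (I : Instance V k) : ℕ → Config V k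
  | 0 =>
    { mem := fun i => A.init (I.id i)
      pos := fun _ => I.root
      last := fun _ => LastMove.stayed
      claim := fun _ => none
      board := fun _ => [] }
  | t + 1 => step A I t (run A I t)

/-- Agent `i` has survived, has terminated, and the port that it declares is an edge of the
footprint from its node to the black hole. -/
def HasFound (I : Instance V k) (C : Config V k) (i : Fin k) : Prop :=
  Alive I C i ∧ ∃ p, C.claim i = some p ∧ I.ports.LeadsTo (C.pos i) p I.bh

/-- The number of bits stored by agent `i`: its identifier and its memory. -/
def agentBits (I : Instance V k) (C : Config V k) (i : Fin k) : ℕ :=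
  Nat.size (I.id i) + (C.mem i).length

/-- The number of bits stored on the whiteboard of `v`. -/
def nodeBits (C : Config V k) (v : V) : ℕ := (C.board v).length

/-- The algorithm solves the instance within `T` rounds: an agent never terminates with a wrong
declaration, and after `T` rounds some agent has found the black hole, survived and terminated. -/
def SolvesWithin (A : Algorithm) (I : Instance V k) (T : ℕ) : Prop :=
  (∀ t i, (run A I t).claim i ≠ none → HasFound I (run A I t) i) ∧
    ∃ i, HasFound I (run A I T) i

/-- During the first `T` rounds no agent and no node ever stores more than `B` bits. -/
def UsesBitsWithin (A : Algorithm) (I : Instance V k) (T B : ℕ) : Prop :=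
  ∀ t ≤ T, (∀ i, agentBits I (run A I t) i ≤ B) ∧ ∀ v, nodeBits (run A I t) v ≤ B

end Dynamics

end BHS

/-! Ranked by identifier, the nine agents form three groups of three. Each group runs its own
depth-first search, with its own slot on every whiteboard; move rounds and think rounds alternate,
and a pair of them is a macro round. A group crosses an edge in three steps: role `0` goes ahead,
then role `1` crosses while role `0` comes back, then roles `0` and `2` follow. In the second step
the same edge is used in both directions in the same round, so both traversals succeed or both fail.
Hence if role `2` is left without both partners, the edge was present and role `0` did not return:
the other end is the black hole. A missing edge delays a crossing but never causes a wrong claim.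

Group `0` waits for its edge as long as necessary. Its search cannot end without meeting the black
hole, because the visited nodes would be closed under adjacency (`Core.not_complete`). So it
advances fewer than `30|E|` times, and it remains to bound each wait by `O(|E|)`.

While group `0` waits, its edge `e` is missing, so every other edge is present (`Period`). Groups
`1` and `2` do not wait for an edge that they have not begun to cross: they skip the port, or, on a
step back, abandon the search and start a new one. They are never split by the same edge
(`groupRun_exclusive`), so one of them is not split by `e`, and cannot become so while `e` is
missing. That group is never stuck, so after `O(|E|)` macro rounds it starts a new search. The new
search never enters a node through `e` and skips at most `e`. Hence it is never stopped on a step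
back, and it cannot be completed, since the footprint without `e` is connected; but the measure of
progress would force it to end after `O(|E|)` further macro rounds. So a wait of that length is
impossible unless a group identifies the black hole (`Period.false`).

Exclusiveness requires a group to give up an edge on which the other one is split. Turns are three
macro rounds apart, the duration of an unhindered crossing, so after a short delay this happens only
at `e` (`Period.edge_eq`).

All this is proved for abstract group states (`groupRun`). The relations `Represents` and `Between`
transfer it to configurations, and since every stored number is at most `n + t` in round `t`, the
codes have `O(log n)` bits. -/

namespace BHS

/-! ### The algorithm -/

/-- The natural number with the given binary digits, least significant first. -/
def natOfBits : List Bool → ℕ := List.foldr Nat.bit 0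

theorem natOfBits_bits (n : ℕ) : natOfBits n.bits = n := by
  induction n using Nat.binaryRec' with
  | zero => simp [natOfBits]
  | bit b n h ih =>
    rw [Nat.bits_append_bit n b h]
    exact congrArg (Nat.bit b) ih

/-- The memory of an agent: its group and role, the number of the round, the version of the
depth-first search of its group, the port at its present node of the edge that the group crosses,
whether this crossing is a step back, and whether the group is split by it. -/
structure Mem where
  grp : Fin 3
  role : Fin 3
  clock : ℕ
  ver : ℕ
  port : ℕ
  back : Bool
  crossing : Bool

/-- What a group writes at a node: the version of the search that visited it last, the port to the
parent increased by one (`0` at the root of the search), and the next port to be explored. -/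
structure Slot where
  ver : ℕ
  par : ℕ
  ptr : ℕ

/-- A whiteboard holds one slot for each group. -/
abbrev Board := Fin 3 → Slot

def Mem.code (m : Mem) : ℕ :=
  Nat.pair m.grp (Nat.pair m.role (Nat.pair m.clock (Nat.pair m.ver
    (Nat.pair m.port (Nat.pair m.back.toNat m.crossing.toNat)))))

def Mem.ofCode (x : ℕ) : Mem :=
  let x1 := x.unpair.2
  let x2 := x1.unpair.2
  let x3 := x2.unpair.2
  let x4 := x3.unpair.2
  let x5 := x4.unpair.2
  { grp := Fin.ofNat 3 x.unpair.1
    role := Fin.ofNat 3 x1.unpair.1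
    clock := x2.unpair.1
    ver := x3.unpair.1
    port := x4.unpair.1
    back := x5.unpair.1 = 1
    crossing := x5.unpair.2 = 1 }

theorem Mem.ofCode_code (m : Mem) : Mem.ofCode m.code = m := by
  rcases m with ⟨g, k, c, v, p, b, x⟩
  cases b <;> cases x <;> simp [Mem.ofCode, Mem.code]

def Mem.enc (m : Mem) : List Bool := m.code.bits

def Mem.dec (l : List Bool) : Mem := Mem.ofCode (natOfBits l)

@[simp]
theorem Mem.dec_enc (m : Mem) : Mem.dec m.enc = m := by
  rw [Mem.dec, Mem.enc, natOfBits_bits, Mem.ofCode_code]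

def Slot.code (s : Slot) : ℕ := Nat.pair s.ver (Nat.pair s.par s.ptr)

def Slot.ofCode (x : ℕ) : Slot := ⟨x.unpair.1, x.unpair.2.unpair.1, x.unpair.2.unpair.2⟩

theorem Slot.ofCode_code (s : Slot) : Slot.ofCode s.code = s := by
  simp [Slot.ofCode, Slot.code]

def Board.code (b : Board) : ℕ := Nat.pair (b 0).code (Nat.pair (b 1).code (b 2).code)

def Board.ofCode (x : ℕ) : Board :=
  ![Slot.ofCode x.unpair.1, Slot.ofCode x.unpair.2.unpair.1, Slot.ofCode x.unpair.2.unpair.2]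

theorem Board.ofCode_code (b : Board) : Board.ofCode b.code = b := by
  funext g
  fin_cases g <;> simp [Board.ofCode, Board.code, Slot.ofCode_code]

def Board.enc (b : Board) : List Bool := b.code.bits

def Board.dec (l : List Bool) : Board := Board.ofCode (natOfBits l)

@[simp]
theorem Board.dec_enc (b : Board) : Board.dec b.enc = b := by
  rw [Board.dec, Board.enc, natOfBits_bits, Board.ofCode_code]

/-- An untouched whiteboard reads as version `0` in every slot. Searches have versions from `1` on,
so this means "not visited". -/
theorem Board.dec_nil (g : Fin 3) : Board.dec [] g = ⟨0, 0, 0⟩ := by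
  have h : Nat.unpair 0 = (0, 0) := by decide
  fin_cases g <;> simp [Board.dec, natOfBits, Board.ofCode, Slot.ofCode, h]

/-- What a group decides when it is gathered at a node: the version of its search, the port that it
tries to cross next, whether this is a step back, and the new contents of its slot. -/
structure Nav where
  ver : ℕ
  port : ℕ
  back : Bool
  slot : Slot

/-- A new search, rooted at the present node. -/
def Nav.restart (ver : ℕ) : Nav := ⟨ver + 1, 0, false, ⟨ver + 1, 0, 0⟩⟩

/-- Explore port `ptr`, or go back to the parent if all ports have been explored. -/
def Nav.advance (ver par ptr deg : ℕ) : Nav :=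
  if ptr < deg then ⟨ver, ptr, false, ⟨ver, par, ptr⟩⟩
  else if par = 0 then Nav.restart ver
  else ⟨ver, par - 1, true, ⟨ver, par, ptr⟩⟩

/-- The group has entered a node with slot `s` through port `q`. -/
def Nav.arrive (ver q : ℕ) (back : Bool) (s : Slot) (deg : ℕ) : Nav :=
  if back then Nav.advance ver s.par (q + 1) deg
  else if s.ver = ver then ⟨ver, q, true, s⟩
  else Nav.advance ver (q + 1) 0 deg

/-- The group gives up crossing port `p` of a node with slot `s`. -/
def Nav.refuse (ver p : ℕ) (back : Bool) (s : Slot) (deg : ℕ) : Nav :=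
  if back then Nav.restart ver else Nav.advance ver s.par (p + 1) deg

/-- Write `x` into the slot of group `g`. -/
def writeSlot (g : Fin 3) (x : Slot) (b : List Bool) : List Bool :=
  Board.enc (Function.update (Board.dec b) g x)

/-- The macro rounds `r` in which groups `1` and `2` may start a crossing. -/
def IsTurn (g : Fin 3) (r : ℕ) : Prop := r % 9 = 3 * g.val

instance (g : Fin 3) (r : ℕ) : Decidable (IsTurn g r) := inferInstanceAs (Decidable (_ = _))

namespace View

/-- The member with role `k` of the group of `m` is among the other agents here. -/
def Here (v : View) (m : Mem) (k : Fin 3) : Prop :=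
  ∃ x ∈ v.others, (Mem.dec x.2).grp = m.grp ∧ (Mem.dec x.2).role = k

instance (v : View) (m : Mem) (k : Fin 3) : Decidable (v.Here m k) :=
  inferInstanceAs (Decidable (∃ x ∈ v.others, _))

/-- The whole group of `m` is here. -/
def Gathered (v : View) (m : Mem) : Prop := ∀ k, k = m.role ∨ v.Here m k

instance (v : View) (m : Mem) : Decidable (v.Gathered m) :=
  inferInstanceAs (Decidable (∀ _, _))

/-- Another group than those of index `0` and of `m` is split by the edge that `m` wants to cross. -/
def Denied (v : View) (m : Mem) : Prop :=
  ∃ x ∈ v.others, (Mem.dec x.2).crossing = true ∧ (Mem.dec x.2).port = m.port ∧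
    (Mem.dec x.2).grp ≠ 0 ∧ (Mem.dec x.2).grp ≠ m.grp

instance (v : View) (m : Mem) : Decidable (v.Denied m) :=
  inferInstanceAs (Decidable (∃ x ∈ v.others, _))

/-- The port through which the agent entered its present node, if it has just done so. -/
def entry (v : View) (m : Mem) : ℕ :=
  match v.last with
  | LastMove.arrived q => q
  | _ => m.port

/-- The number of agents here with a smaller identifier. -/
def rank (v : View) : ℕ := (v.others.filter fun x => x.1 < v.id).card

end View

/-- The action of an agent in a move round. -/
def moveAct (v : View) (m : Mem) : Action :=
  if m.crossing then
    if m.role = 0 then Action.move m.port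
    else if m.role = 1 then
      if v.Here m 2 then Action.move m.port else Action.stay
    else if v.Here m 0 then Action.move m.port
    else if v.Here m 1 then Action.stay
    else Action.terminate m.port
  else if m.role = 0 ∧ (m.grp = 0 ∨ IsTurn m.grp ((m.clock - 1) / 2) ∧ ¬ v.Denied m) then
    Action.move m.port
  else Action.stay

/-- The new navigation data that a gathered group computes in a think round. -/
def thinkNav (v : View) (m : Mem) : Option Nav :=
  if v.Gathered m then
    if m.crossing then
      some (Nav.arrive m.ver (v.entry m) m.back (Board.dec v.board m.grp) v.deg)
    else if m.grp ≠ 0 ∧ IsTurn m.grp ((m.clock - 1) / 2) then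
      some (Nav.refuse m.ver m.port m.back (Board.dec v.board m.grp) v.deg)
    else none
  else none

/-- The memory of an agent after a think round. -/
def thinkMem (v : View) (m : Mem) : Mem :=
  match thinkNav v m with
  | some n => ⟨m.grp, m.role, m.clock + 1, n.ver, n.port, n.back, false⟩
  | none =>
    if v.Gathered m then { m with clock := m.clock + 1 }
    else { m with clock := m.clock + 1, port := v.entry m, crossing := true }

/-- The modification of the whiteboard in a think round. -/
def thinkEdit (v : View) (m : Mem) (b : List Bool) : List Bool :=
  match thinkNav v m with
  | some n => writeSlot m.grp n.slot b
  | none => b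

/-- The memory of an agent after round `0`. -/
def firstMem (v : View) : Mem :=
  ⟨Fin.ofNat 3 (v.rank / 3), Fin.ofNat 3 (v.rank % 3), 1, 1, 0, false, false⟩

/-- The empty initial memory decodes to clock `0`, which marks round `0`; afterwards odd clocks are
move rounds and even ones think rounds. -/
def searchDecision (v : View) : Decision :=
  let m := Mem.dec v.mem
  if m.clock = 0 then
    ⟨(firstMem v).enc, writeSlot (firstMem v).grp (Nav.restart 0).slot, Action.stay⟩
  else if m.clock % 2 = 1 then
    ⟨({ m with clock := m.clock + 1 } : Mem).enc, id, moveAct v m⟩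
  else ⟨(thinkMem v m).enc, thinkEdit v m, Action.stay⟩

/-- Three groups of three agents, each of which searches depth first. -/
def searchAlgorithm : Algorithm where
  init _ := []
  compute := searchDecision

end BHS

/-! ### Ports and edge counts of the footprint -/

namespace BHS

section Ports

variable {V : Type*}

open Classical in
/-- The node behind port `p` of `u`. -/
noncomputable def PortGraph.far (P : PortGraph V) (u : V) (p : ℕ) : V :=
  if h : p < Nat.card (P.graph.neighborSet u) then P.port u ⟨p, h⟩ else u

namespace PortGraph

theorem far_eq {P : PortGraph V} {u : V} {p : ℕ} (h : p < Nat.card (P.graph.neighborSet u)) :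
    P.far u p = P.port u ⟨p, h⟩ := dif_pos h

theorem adj_far {P : PortGraph V} {u : V} {p : ℕ} (h : p < P.deg u) :
    P.graph.Adj u (P.far u p) := by
  rw [far_eq h]; exact (P.port u ⟨p, h⟩).2

open Classical in
/-- The port at the other end of the edge behind port `p` of `u`. -/
noncomputable def ent (P : PortGraph V) (u : V) (p : ℕ) : ℕ :=
  if h : p < P.deg u then ((P.port (P.far u p)).symm ⟨u, (adj_far h).symm⟩ : Fin _) else 0

variable {P : PortGraph V} {u v : V} {p q : ℕ}

theorem far_ne (h : p < P.deg u) : P.far u p ≠ u := (adj_far h).ne'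

theorem far_injective (hp : p < P.deg u) (hq : q < P.deg u) (h : P.far u p = P.far u q) :
    p = q := by
  rw [far_eq hp, far_eq hq] at h
  exact congrArg Fin.val ((P.port u).injective (Subtype.ext h))

theorem exists_far (h : P.graph.Adj u v) : ∃ p < P.deg u, P.far u p = v := by
  refine ⟨((P.port u).symm ⟨v, h⟩ : Fin _), ((P.port u).symm ⟨v, h⟩).2, ?_⟩
  rw [far_eq ((P.port u).symm ⟨v, h⟩).2]
  exact congrArg Subtype.val ((P.port u).apply_symm_apply ⟨v, h⟩)

theorem ent_eq (h : p < P.deg u) :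
    P.ent u p = ((P.port (P.far u p)).symm ⟨u, (adj_far h).symm⟩ : Fin _) := dif_pos h

theorem ent_lt (h : p < P.deg u) : P.ent u p < P.deg (P.far u p) := by
  rw [ent_eq h]
  exact Fin.is_lt _

theorem far_far (h : p < P.deg u) : P.far (P.far u p) (P.ent u p) = u := by
  have h1 : (⟨P.ent u p, ent_lt h⟩ : Fin (Nat.card (P.graph.neighborSet (P.far u p)))) =
      (P.port (P.far u p)).symm ⟨u, (adj_far h).symm⟩ := Fin.ext (ent_eq h)
  rw [far_eq (ent_lt h), h1]
  exact congrArg Subtype.val ((P.port (P.far u p)).apply_symm_apply _)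

theorem ent_ent (h : p < P.deg u) : P.ent (P.far u p) (P.ent u p) = p := by
  have h1 := ent_lt h
  have h2 := ent_lt h1
  rw [far_far h] at h2
  apply far_injective h2 h
  have := far_far h1
  rw [far_far h] at this
  exact this

theorem leadsTo_far (h : p < P.deg u) : P.LeadsTo u p (P.far u p) := ⟨h, (far_eq h).symm⟩

theorem edge_eq_iff (hp : p < P.deg u) (hq : q < P.deg v) :
    s(u, P.far u p) = s(v, P.far v q) ↔
      (u = v ∧ p = q) ∨ (P.far v q = u ∧ P.ent v q = p) := by
  constructor
  · intro h
    rw [Sym2.eq_iff] at h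
    rcases h with ⟨rfl, h⟩ | ⟨h1, h2⟩
    · exact Or.inl ⟨rfl, far_injective hp hq h⟩
    · subst h1
      right
      refine ⟨rfl, far_injective (ent_lt hq) hp ?_⟩
      rw [far_far hq, h2]
  · rintro (⟨rfl, rfl⟩ | ⟨rfl, rfl⟩)
    · rfl
    · rw [far_far hq, Sym2.eq_swap]

open Classical in
theorem traverse_eq (h : p < P.deg u) (H : SimpleGraph V) :
    traverse P H u p = if H.Adj u (P.far u p) then
      (P.far u p, LastMove.arrived (P.ent u p)) else (u, LastMove.blocked) := by
  have key : ∀ w (hw : P.graph.Adj u w), w = P.far u p →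
      ((P.port w).symm ⟨u, hw.symm⟩ : Fin _).val = P.ent u p := by
    rintro w hw rfl
    exact (ent_eq h).symm
  have h' : p < Nat.card (P.graph.neighborSet u) := h
  rw [traverse, dif_pos h', key _ (P.port u ⟨p, h'⟩).2 (far_eq h).symm, ← far_eq h']

variable [Fintype V]

theorem sum_deg (P : PortGraph V) : ∑ x, P.deg x = 2 * P.numEdges := by
  classical
  rw [numEdges, ← SimpleGraph.coe_edgeFinset, Set.ncard_coe_finset,
    ← SimpleGraph.sum_degrees_eq_twice_card_edges]
  refine Finset.sum_congr rfl fun x _ => ?_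
  rw [deg, Nat.card_eq_fintype_card, SimpleGraph.card_neighborSet_eq_degree]

theorem card_le (h : P.graph.Connected) : Fintype.card V ≤ P.numEdges + 1 := by
  have := h.card_vert_le_card_edgeSet_add_one
  rwa [Nat.card_eq_fintype_card] at this

theorem deg_lt (u : V) : P.deg u < Fintype.card V := by
  classical
  rw [deg, Nat.card_eq_fintype_card, SimpleGraph.card_neighborSet_eq_degree]
  exact SimpleGraph.degree_lt_card_verts _

theorem numEdges_le (P : PortGraph V) : P.numEdges ≤ Fintype.card V ^ 2 := by
  have h1 := P.sum_deg
  have h2 : ∑ x, P.deg x ≤ ∑ _x : V, Fintype.card V :=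
    Finset.sum_le_sum fun x _ => (deg_lt x).le
  rw [Finset.sum_const, Finset.card_univ, smul_eq_mul] at h2
  nlinarith

theorem deg_pos (h : P.graph.Connected) (hn : 1 < Fintype.card V) (u : V) : 0 < P.deg u := by
  classical
  have := Fintype.one_lt_card_iff_nontrivial.1 hn
  rw [deg, Nat.card_eq_fintype_card, SimpleGraph.card_neighborSet_eq_degree]
  exact h.preconnected.degree_pos_of_nontrivial u

end PortGraph

end Ports

end BHS

/-! ### The invariant of a depth-first search that may skip edges -/

namespace BHS

section Search

variable {V : Type*}

/-- The nodes from the present node of a depth-first search to its root: each node was entered from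
the next one, through an edge not in `F`. -/
inductive Stack (P : PortGraph V) (F : Set (Sym2 V)) (sl : V → Slot) : List V → Prop
  | root {x : V} : (sl x).par = 0 → Stack P F sl [x]
  | push {x y : V} {L : List V} : (sl y).ptr < P.deg y → P.far y (sl y).ptr = x →
      (sl x).par = P.ent y (sl y).ptr + 1 → s(y, x) ∉ F → Stack P F sl (y :: L) →
      Stack P F sl (x :: y :: L)

/-- Pointers matter only below the top, where they name the edge to the next node up; the top node
is free to advance its own pointer. -/
theorem Stack.congr {P : PortGraph V} {F : Set (Sym2 V)} {sl sl' : V → Slot} {L : List V} :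
    ∀ {u : V}, Stack P F sl (u :: L) → (∀ x ∈ u :: L, (sl' x).par = (sl x).par) →
      (∀ x ∈ L, (sl' x).ptr = (sl x).ptr) → Stack P F sl' (u :: L) := by
  induction L with
  | nil =>
    intro u h h1 _
    cases h with
    | root h => exact .root (by rw [h1 u (by simp), h])
  | cons y L ih =>
    intro u h h1 h2
    cases h with
    | push a b c d e =>
      have hy := h2 y (by simp)
      refine .push (by rwa [hy]) (by rwa [hy]) ?_ d (ih e ?_ ?_)
      · rw [hy, h1 u (by simp), c]
      · intro x hx; exact h1 x (List.mem_cons_of_mem _ hx)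
      · intro x hx; exact h2 x (List.mem_cons_of_mem _ hx)

/-- The invariant of a depth-first search with version `ver` and present node `u`: ports before
`ptr` lead to visited nodes, unless the edge lies in `A`. -/
structure Core (P : PortGraph V) (bh : V) (A F : Set (Sym2 V)) (ver : ℕ) (sl : V → Slot) (u : V) :
    Prop where
  stack : ∃ L, Stack P F sl (u :: L) ∧ (u :: L).Nodup ∧ (∀ x ∈ u :: L, (sl x).ver = ver) ∧
    ∀ x, (sl x).ver = ver → x ∉ u :: L → P.deg x ≤ (sl x).ptr
  ptr_le : ∀ x, (sl x).ver = ver → (sl x).ptr ≤ P.deg x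
  closed : ∀ x, (sl x).ver = ver → ∀ p < (sl x).ptr,
    (sl (P.far x p)).ver = ver ∨ s(x, P.far x p) ∈ A
  ver_le : ∀ x, (sl x).ver ≤ ver
  safe : ∀ x, (sl x).ver = ver → x ≠ bh

variable {P : PortGraph V} {bh : V} {A F : Set (Sym2 V)} {ver : ℕ} {sl : V → Slot} {u : V}

theorem Core.visited (h : Core P bh A F ver sl u) : (sl u).ver = ver := by
  obtain ⟨L, -, -, h, -⟩ := h.stack
  exact h u (by simp)

-- Only the top of the stack moves its pointer, and the port passed over leads to a visited node or
-- is one that `A` allows to skip.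
open Classical in
theorem Core.bump (h : Core P bh A F ver sl u) (hp : (sl u).ptr < P.deg u)
    (hA : (sl (P.far u (sl u).ptr)).ver = ver ∨ s(u, P.far u (sl u).ptr) ∈ A) :
    Core P bh A F ver (Function.update sl u ⟨ver, (sl u).par, (sl u).ptr + 1⟩) u := by
  have hv : ∀ x, (Function.update sl u ⟨ver, (sl u).par, (sl u).ptr + 1⟩ x).ver = (sl x).ver := by
    intro x
    by_cases hx : x = u
    · subst hx; simp [h.visited]
    · simp [hx]
  have hpar : ∀ x, (Function.update sl u ⟨ver, (sl u).par, (sl u).ptr + 1⟩ x).par = (sl x).par := by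
    intro x
    by_cases hx : x = u
    · subst hx; simp
    · simp [hx]
  constructor
  · obtain ⟨L, h1, h2, h3, h4⟩ := h.stack
    refine ⟨L, h1.congr (fun x _ => hpar x) ?_, h2, ?_, ?_⟩
    · intro x hx
      have : x ≠ u := fun h => (List.nodup_cons.1 h2).1 (h ▸ hx)
      simp [this]
    · intro x hx; rw [hv]; exact h3 x hx
    · intro x hx hL
      have : x ≠ u := fun h => hL (h ▸ by simp)
      rw [hv] at hx
      simpa [this] using h4 x hx hL
  · intro x hx
    rw [hv] at hx
    by_cases hu : x = u
    · subst hu; simpa using hp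
    · simpa [hu] using h.ptr_le x hx
  · intro x hx p hp'
    rw [hv] at hx ⊢
    by_cases hu : x = u
    · subst hu
      simp only [Function.update_self] at hp'
      rcases Nat.lt_succ_iff_lt_or_eq.1 hp' with hp' | rfl
      · exact h.closed x hx p hp'
      · exact hA
    · simp only [Function.update_of_ne hu] at hp'
      exact h.closed x hx p hp'
  · intro x; rw [hv]; exact h.ver_le x
  · intro x hx; rw [hv] at hx; exact h.safe x hx

-- The pointer of `u` stays on the tree edge to `v` until the search comes back; this is how `Stack`
-- recognises the child.
open Classical in
theorem Core.push (h : Core P bh A F ver sl u) (hp : (sl u).ptr < P.deg u)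
    {v : V} (hv : P.far u (sl u).ptr = v) (hnew : (sl v).ver ≠ ver) (hbh : v ≠ bh)
    (hF : s(u, v) ∉ F) :
    Core P bh A F ver (Function.update sl v ⟨ver, P.ent u (sl u).ptr + 1, 0⟩) v := by
  have hne : ∀ x, (sl x).ver = ver → x ≠ v := fun x hx he => hnew (he ▸ hx)
  have hold : ∀ x, (sl x).ver = ver →
      Function.update sl v ⟨ver, P.ent u (sl u).ptr + 1, 0⟩ x = sl x := by
    intro x hx; simp [hne x hx]
  constructor
  · obtain ⟨L, h1, h2, h3, h4⟩ := h.stack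
    refine ⟨u :: L, .push ?_ ?_ ?_ hF (h1.congr ?_ ?_), ?_, ?_, ?_⟩
    · rwa [hold u h.visited]
    · rwa [hold u h.visited]
    · rw [hold u h.visited]; simp
    · intro x hx; rw [hold x (h3 x hx)]
    · intro x hx; rw [hold x (h3 x (List.mem_cons_of_mem _ hx))]
    · refine List.nodup_cons.2 ⟨fun hx => hne v (h3 v hx) rfl, h2⟩
    · intro x hx
      rcases List.mem_cons.1 hx with rfl | hx
      · simp
      · rw [hold x (h3 x hx)]; exact h3 x hx
    · intro x hx hL
      have hxv : x ≠ v := fun h => hL (h ▸ by simp)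
      rw [Function.update_of_ne hxv] at hx ⊢
      exact h4 x hx fun hm => hL (List.mem_cons_of_mem _ hm)
  · intro x hx
    by_cases hxv : x = v
    · subst hxv; simp
    · rw [Function.update_of_ne hxv] at hx ⊢
      exact h.ptr_le x hx
  · intro x hx p hp'
    by_cases hxv : x = v
    · subst hxv; simp at hp'
    · rw [Function.update_of_ne hxv] at hx hp'
      rcases h.closed x hx p hp' with h5 | h5
      · left; rw [hold _ h5]; exact h5
      · exact Or.inr h5
  · intro x
    by_cases hxv : x = v
    · subst hxv; simp
    · rw [Function.update_of_ne hxv]; exact h.ver_le x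
  · intro x hx
    by_cases hxv : x = v
    · subst hxv; exact hbh
    · rw [Function.update_of_ne hxv] at hx
      exact h.safe x hx

/-- The pointer of the parent still names the edge to `u`, so the step back enters the parent
through exactly the port that is to be passed over next. -/
theorem Core.pop (h : Core P bh A F ver sl u) (hp : P.deg u ≤ (sl u).ptr) (hpar : (sl u).par ≠ 0) :
    (sl u).par - 1 < P.deg u ∧
      P.ent u ((sl u).par - 1) = (sl (P.far u ((sl u).par - 1))).ptr ∧
      s(u, P.far u ((sl u).par - 1)) ∉ F ∧ Core P bh A F ver sl (P.far u ((sl u).par - 1)) := by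
  obtain ⟨L, h1, h2, h3, h4⟩ := h.stack
  cases h1 with
  | root h => exact absurd h hpar
  | @push _ y L a b c d e =>
    subst b
    have hy : P.far (P.far y (sl y).ptr) ((sl (P.far y (sl y).ptr)).par - 1) = y := by
      rw [c]; exact PortGraph.far_far a
    rw [hy, Sym2.eq_swap]
    refine ⟨?_, ?_, d, ⟨L, e, (List.nodup_cons.1 h2).2,
      fun x hx => h3 x (List.mem_cons_of_mem _ hx), ?_⟩, h.ptr_le, h.closed, h.ver_le, h.safe⟩
    · rw [c]; exact PortGraph.ent_lt a
    · rw [c]; exact PortGraph.ent_ent a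
    · intro x hx hL
      by_cases hxu : x = P.far y (sl y).ptr
      · subst hxu; exact hp
      · exact h4 x hx fun hm => hL ((List.mem_cons.1 hm).resolve_left hxu)

/-- A completed search is impossible if a connected spanning subgraph avoids the edges of `A`. -/
theorem Core.not_complete (h : Core P bh A F ver sl u) (hp : P.deg u ≤ (sl u).ptr)
    (hpar : (sl u).par = 0) {H : SimpleGraph V} (hH : H.Connected) (hle : H ≤ P.graph)
    (hA : ∀ e ∈ H.edgeSet, e ∉ A) : False := by
  obtain ⟨L, h1, h2, h3, h4⟩ := h.stack
  -- A pushed node has `par > 0`, so the stack is `[u]` and every visited node is exhausted.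
  have hfull : ∀ x, (sl x).ver = ver → P.deg x ≤ (sl x).ptr := by
    intro x hx
    by_cases hL : x ∈ u :: L
    · cases h1 with
      | root h => rw [List.mem_singleton] at hL; subst hL; exact hp
      | push a b c d e => omega
    · exact h4 x hx hL
  have key : ∀ x, H.Reachable u x → (sl x).ver = ver := by
    rintro x ⟨w⟩
    have : ∀ {a b : V} (_ : H.Walk a b), (sl a).ver = ver → (sl b).ver = ver := by
      intro a b w
      induction w with
      | nil => exact id
      | cons hadj _ ih =>
        intro ha
        apply ih
        obtain ⟨p, hp, rfl⟩ := PortGraph.exists_far (hle hadj)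
        exact (h.closed _ ha p (hp.trans_le (hfull _ ha))).resolve_right (hA _ hadj)
    exact this w h.visited
  exact h.safe bh (key bh (hH.preconnected u bh)) rfl

-- All older versions become outdated, so only `u` counts as visited. No port has been passed and
-- there is no tree edge yet, hence `A` and `F` can be chosen anew at every restart.
open Classical in
theorem Core.fresh (hle : ∀ x, (sl x).ver ≤ ver) (hu : u ≠ bh) :
    Core P bh A F (ver + 1) (Function.update sl u ⟨ver + 1, 0, 0⟩) u := by
  have hv : ∀ x, (Function.update sl u ⟨ver + 1, 0, 0⟩ x).ver = ver + 1 → x = u := by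
    intro x hx
    by_contra hxu
    rw [Function.update_of_ne hxu] at hx
    have := hle x
    omega
  constructor
  · refine ⟨[], .root (by simp), by simp, by simp, ?_⟩
    intro x hx hL
    exact absurd (hv x hx) (by simpa using hL)
  · intro x hx; rw [hv x hx]; simp
  · intro x hx p hp; rw [hv x hx] at hp; simp at hp
  · intro x
    by_cases hxu : x = u
    · subst hxu; simp
    · rw [Function.update_of_ne hxu]; have := hle x; omega
  · intro x hx; rw [hv x hx]; exact hu

/-- The stages of a crossing. -/
inductive Phase where
  | home
  | out
  | swapped
  | lone
  | done

/-- The state of a group: the node from which it crosses, the port through which it crosses, whether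
this is a step back, the version of its search, its slots, and the stage of the crossing. -/
structure GroupState (V : Type*) where
  loc : V
  port : ℕ
  back : Bool
  ver : ℕ
  slots : V → Slot
  phase : Phase

namespace GroupState

/-- The other end of the edge to be crossed. -/
noncomputable def far (P : PortGraph V) (s : GroupState V) : V := P.far s.loc s.port

/-- The port at the other end of the edge to be crossed. -/
noncomputable def ent (P : PortGraph V) (s : GroupState V) : ℕ := P.ent s.loc s.port

/-- The edge to be crossed. -/
noncomputable def edge (P : PortGraph V) (s : GroupState V) : Sym2 V := s(s.loc, s.far P)

open Classical in
/-- The group is gathered at `u` and has taken the decision `n`. -/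
noncomputable def settle (s : GroupState V) (u : V) (n : Nav) : GroupState V where
  loc := u
  port := n.port
  back := n.back
  ver := n.ver
  slots := Function.update s.slots u n.slot
  phase := Phase.home

/-- The group after it has crossed its edge. -/
noncomputable def landed (P : PortGraph V) (s : GroupState V) : GroupState V :=
  s.settle (s.far P)
    (Nav.arrive s.ver (s.ent P) s.back (s.slots (s.far P)) (P.deg (s.far P)))

/-- The group after it has given up crossing its edge. -/
noncomputable def refused (P : PortGraph V) (s : GroupState V) : GroupState V :=
  s.settle s.loc (Nav.refuse s.ver s.port s.back (s.slots s.loc) (P.deg s.loc))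

/-- The invariant of the search of a group. -/
def Inv (P : PortGraph V) (bh : V) (A F : Set (Sym2 V)) (s : GroupState V) : Prop :=
  s.port < P.deg s.loc ∧ (s.slots s.loc).ver = s.ver ∧ s.loc ≠ bh ∧
    if s.back then Core P bh A F s.ver s.slots (s.far P) ∧
      s.ent P = (s.slots (s.far P)).ptr ∧ s.edge P ∉ F
    else Core P bh A F s.ver s.slots s.loc ∧ s.port = (s.slots s.loc).ptr

theorem Inv.ver_le {s : GroupState V} (h : s.Inv P bh A F) (x : V) : (s.slots x).ver ≤ s.ver := by
  obtain ⟨-, -, -, h⟩ := h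
  split at h
  · exact h.1.ver_le x
  · exact h.1.ver_le x

theorem Inv.ptr_le {s : GroupState V} (h : s.Inv P bh A F) (x : V) (hx : (s.slots x).ver = s.ver) :
    (s.slots x).ptr ≤ P.deg x := by
  obtain ⟨-, -, -, h⟩ := h
  split at h
  · exact h.1.ptr_le x hx
  · exact h.1.ptr_le x hx

open Classical in
theorem inv_settle_restart (hdeg : ∀ x, 0 < P.deg x) {s : GroupState V}
    (hle : ∀ x, (s.slots x).ver ≤ s.ver) (hu : u ≠ bh) (A F : Set (Sym2 V)) :
    (s.settle u (Nav.restart s.ver)).Inv P bh A F := by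
  refine ⟨hdeg u, by simp [settle, Nav.restart], hu, ?_⟩
  simp only [settle, Nav.restart, Bool.false_eq_true, if_false, Function.update_self, and_true]
  exact Core.fresh hle hu

-- The search leaves its version only if the root itself is exhausted; the second alternative
-- records what `Core.not_complete` needs.
open Classical in
theorem inv_settle_advance (s : GroupState V) {par ptr : ℕ}
    (h : Core P bh A F s.ver (Function.update s.slots u ⟨s.ver, par, ptr⟩) u) :
    (s.settle u (Nav.advance s.ver par ptr (P.deg u))).Inv P bh A F ∧
      (Nav.advance s.ver par ptr (P.deg u)).ver = s.ver ∧
      (Nav.advance s.ver par ptr (P.deg u)).slot = ⟨s.ver, par, ptr⟩ ∨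
    Nav.advance s.ver par ptr (P.deg u) = Nav.restart s.ver ∧ P.deg u ≤ ptr ∧ par = 0 := by
  have hu : u ≠ bh := h.safe u h.visited
  unfold Nav.advance
  split
  · rename_i hp
    left
    exact ⟨⟨hp, by simp [settle], hu, by simpa [settle] using h⟩, rfl, rfl⟩
  · rename_i hp
    split
    · rename_i hpar
      exact Or.inr ⟨rfl, not_lt.1 hp, hpar⟩
    · rename_i hpar
      left
      have := h.pop (by simpa using hp) (by simpa using hpar)
      simp only [Function.update_self] at this
      obtain ⟨h1, h2, h3, h4⟩ := this
      refine ⟨⟨h1, by simp [settle], hu, ?_⟩, rfl, rfl⟩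
      simp only [settle, if_true]
      exact ⟨h4, h2, h3⟩

end GroupState

end Search

end BHS

/-! ### The measure of progress and the decisions of a group -/

namespace BHS

namespace GroupState

section Work

variable {V : Type*} [Fintype V]

/-- The contribution of a slot to the measure of progress of a search. -/
def slotWork (ver : ℕ) (x : Slot) : ℕ := if x.ver = ver then 2 * x.ptr + 2 else 0

/-- The measure of progress of a search within one version. -/
def work (s : GroupState V) : ℕ := ∑ x, slotWork s.ver (s.slots x) + s.back.toNat

theorem work_settle (s : GroupState V) (u : V) {n : Nav} (hn : n.ver = s.ver) :
    (s.settle u n).work + slotWork s.ver (s.slots u) + s.back.toNat =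
      s.work + slotWork s.ver n.slot + n.back.toNat := by
  classical
  have h1 : ∑ x, slotWork s.ver ((s.settle u n).slots x) + slotWork s.ver (s.slots u) =
      ∑ x, slotWork s.ver (s.slots x) + slotWork s.ver n.slot := by
    rw [← Finset.add_sum_erase _ _ (Finset.mem_univ u),
      ← Finset.add_sum_erase _ (fun x => slotWork s.ver (s.slots x)) (Finset.mem_univ u)]
    have : ∑ x ∈ Finset.univ.erase u, slotWork s.ver ((s.settle u n).slots x) =
        ∑ x ∈ Finset.univ.erase u, slotWork s.ver (s.slots x) := by
      refine Finset.sum_congr rfl fun x hx => ?_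
      simp [settle, Finset.ne_of_mem_erase hx]
    rw [this]
    simp only [settle, Function.update_self]
    ring
  have h2 : (s.settle u n).work =
      ∑ x, slotWork s.ver ((s.settle u n).slots x) + n.back.toNat := by
    simp [work, settle, hn]
  rw [h2, work]
  omega

theorem Inv.work_le {P : PortGraph V} {bh : V} {A F : Set (Sym2 V)} {s : GroupState V}
    (h : s.Inv P bh A F) (hc : P.graph.Connected) (hE : 1 ≤ P.numEdges) :
    s.work ≤ 9 * P.numEdges := by
  have h1 : ∑ x, slotWork s.ver (s.slots x) ≤ ∑ x, (2 * P.deg x + 2) := by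
    refine Finset.sum_le_sum fun x _ => ?_
    unfold slotWork
    split
    · rename_i hx
      have := h.ptr_le x hx
      omega
    · omega
  -- The sum is at most `4|E| + 2n` with `n ≤ |E| + 1`, so together with the flag the work is at
  -- most `6|E| + 3`.
  rw [Finset.sum_add_distrib, ← Finset.mul_sum, P.sum_deg, Finset.sum_const, Finset.card_univ,
    smul_eq_mul] at h1
  have h2 := PortGraph.card_le hc
  have h3 : s.back.toNat ≤ 1 := Bool.toNat_le _
  unfold work
  omega

end Work

section Progress

variable {V : Type*} {P : PortGraph V} {bh : V} {A F : Set (Sym2 V)} {s : GroupState V}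

/-- The search of `s` has explored everything that it can reach. -/
def Complete (P : PortGraph V) (bh : V) (A F : Set (Sym2 V)) : Prop :=
  ∃ ver sl u, Core P bh A F ver sl u ∧ P.deg u ≤ (sl u).ptr ∧ (sl u).par = 0

/-- `s'` is the result of progress of `s` within the same version of the search. -/
def Advances [Fintype V] (P : PortGraph V) (bh : V) (A F : Set (Sym2 V)) (s s' : GroupState V) :
    Prop := s'.Inv P bh A F ∧ s'.ver = s.ver ∧ s.work + 1 ≤ s'.work

/-- `s'` is the beginning of a new search after `s`. -/
def Restarts (P : PortGraph V) (bh : V) (s s' : GroupState V) : Prop :=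
  s'.ver = s.ver + 1 ∧ ∀ A F, s'.Inv P bh A F

open Classical in
theorem advance_progress [Fintype V] (hdeg : ∀ x, 0 < P.deg x) {u : V} {par ptr : ℕ}
    (hle : ∀ x, (s.slots x).ver ≤ s.ver)
    (h : Core P bh A F s.ver (Function.update s.slots u ⟨s.ver, par, ptr⟩) u)
    (hw : slotWork s.ver (s.slots u) + s.back.toNat < 2 * ptr + 2) :
    Advances P bh A F s (s.settle u (Nav.advance s.ver par ptr (P.deg u))) ∨
      Restarts P bh s (s.settle u (Nav.advance s.ver par ptr (P.deg u))) ∧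
        Complete P bh A F := by
  rcases inv_settle_advance s h with ⟨h1, h2, h3⟩ | ⟨h1, h2, h3⟩
  · left
    refine ⟨h1, h2, ?_⟩
    have := work_settle s u h2
    rw [h3] at this
    simp only [slotWork, if_true] at this hw
    omega
  · right
    have hu : u ≠ bh := h.safe u h.visited
    rw [h1]
    refine ⟨⟨rfl, inv_settle_restart hdeg hle hu⟩, _, _, _, h, by simpa using h2, by simpa using h3⟩

-- Passing a port gains `2`, which outweighs the possible loss of the flag `back`; this is why
-- `slotWork` counts ports twice.
open Classical in
theorem bump_progress [Fintype V] (hdeg : ∀ x, 0 < P.deg x) {u : V}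
    (hle : ∀ x, (s.slots x).ver ≤ s.ver) (h : Core P bh A F s.ver s.slots u)
    (hp : (s.slots u).ptr < P.deg u)
    (hA : (s.slots (P.far u (s.slots u).ptr)).ver = s.ver ∨
      s(u, P.far u (s.slots u).ptr) ∈ A) :
    let s' := s.settle u (Nav.advance s.ver (s.slots u).par ((s.slots u).ptr + 1) (P.deg u))
    Advances P bh A F s s' ∨ Restarts P bh s s' ∧ Complete P bh A F := by
  refine advance_progress hdeg hle (h.bump hp hA) ?_
  have h3 : s.back.toNat ≤ 1 := Bool.toNat_le _
  simp only [slotWork, h.visited, if_true]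
  omega

/-- Three cases: a step back ends and the pointer passes the port; the node entered is already
visited and the group turns round; the node is new and is pushed. Turning round changes no slot and
gains only through the flag `back`. -/
theorem landed_progress [Fintype V] (hdeg : ∀ x, 0 < P.deg x) (h : s.Inv P bh A F)
    (hF : s.edge P ∉ F) (hbh : s.far P ≠ bh) :
    Advances P bh A F s (s.landed P) ∨ Restarts P bh s (s.landed P) ∧ Complete P bh A F := by
  classical
  have hle := h.ver_le
  obtain ⟨hp, hv, hl, h⟩ := h
  by_cases hb : s.back = true
  · rw [if_pos hb] at h
    obtain ⟨hc, he, -⟩ := h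
    have h1 : (s.slots (s.far P)).ptr < P.deg (s.far P) := by
      rw [← he]; exact PortGraph.ent_lt hp
    have h2 : P.far (s.far P) (s.slots (s.far P)).ptr = s.loc := by
      rw [← he]; exact PortGraph.far_far hp
    have := bump_progress (s := s) hdeg hle hc h1 (by rw [h2]; exact Or.inl hv)
    rw [landed, Nav.arrive, if_pos hb, he]
    exact this
  · rw [if_neg hb] at h
    obtain ⟨hc, he⟩ := h
    have hb' : s.back = false := by simpa using hb
    rw [landed, Nav.arrive, if_neg hb]
    have hpt : (s.slots s.loc).ptr < P.deg s.loc := he ▸ hp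
    split
    · rename_i hvis
      left
      refine ⟨⟨PortGraph.ent_lt hp, by simpa [settle] using hvis, hbh, ?_⟩, rfl, ?_⟩
      · have hff : P.far (s.far P) (s.ent P) = s.loc := PortGraph.far_far hp
        have hee : P.ent (s.far P) (s.ent P) = s.port := PortGraph.ent_ent hp
        simp only [settle, if_true, far, ent, edge, Function.update_eq_self]
        simp only [far, ent] at hff hee
        rw [hff, hee]
        refine ⟨hc, he, ?_⟩
        rw [Sym2.eq_swap]
        exact hF
      · have := work_settle s (s.far P) (n := ⟨s.ver, s.ent P, true, s.slots (s.far P)⟩) rfl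
        simp only [hb', Bool.toNat_true, Bool.toNat_false] at this
        omega
    · rename_i hvis
      have hpush := hc.push hpt (v := s.far P) (by rw [← he]; rfl) hvis hbh hF
      rw [← he] at hpush
      refine advance_progress hdeg hle hpush ?_
      simp [slotWork, hvis, hb']

/-- A forward edge can be skipped because it lies in `A`. A step back cannot be skipped, so the
search is abandoned; by the invariant this happens only at an edge outside `F`, which is what later
excludes the case. -/
theorem refused_progress [Fintype V] (hdeg : ∀ x, 0 < P.deg x) (h : s.Inv P bh A F)
    (hA : s.edge P ∈ A) :
    Advances P bh A F s (s.refused P) ∨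
      Restarts P bh s (s.refused P) ∧ (Complete P bh A F ∨ s.edge P ∉ F) := by
  have hle := h.ver_le
  obtain ⟨hp, hv, hl, h⟩ := h
  by_cases hb : s.back = true
  · rw [if_pos hb] at h
    right
    rw [refused, Nav.refuse, if_pos hb]
    exact ⟨⟨rfl, inv_settle_restart hdeg hle hl⟩, Or.inr h.2.2⟩
  · rw [if_neg hb] at h
    obtain ⟨hc, he⟩ := h
    rw [refused, Nav.refuse, if_neg hb, he]
    have hA' : s(s.loc, P.far s.loc (s.slots s.loc).ptr) ∈ A := by rw [← he]; exact hA
    rcases bump_progress (s := s) hdeg hle hc (he ▸ hp) (Or.inr hA') with h | ⟨h, h'⟩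
    · exact Or.inl h
    · exact Or.inr ⟨h, Or.inl h'⟩

end Progress

section Step

variable {V : Type*}

open Classical in
/-- A macro round of group `g`: `H` is the graph that is present in its move round, and `D` says
that the group may not start its crossing because of another group. -/
noncomputable def next (P : PortGraph V) (bh : V) (g : Fin 3) (r : ℕ) (D : Prop)
    (H : SimpleGraph V) (s : GroupState V) : GroupState V :=
  match s.phase with
  | Phase.home =>
    if (g = 0 ∨ IsTurn g r ∧ ¬ D) ∧ H.Adj s.loc (s.far P) then { s with phase := Phase.out }
    else if g ≠ 0 ∧ IsTurn g r then s.refused P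
    else s
  | Phase.out =>
    if H.Adj s.loc (s.far P) then
      { s with phase := open Classical in if s.far P = bh then Phase.lone else Phase.swapped }
    else s
  | Phase.swapped => if H.Adj s.loc (s.far P) then s.landed P else s
  | Phase.lone => { s with phase := Phase.done }
  | Phase.done => s

end Step

end GroupState

end BHS

/-! ### Macro rounds of the three groups -/

namespace BHS

namespace GroupState

variable {V : Type*}

/-- The number of steps of the present crossing that have been made. -/
def stage (s : GroupState V) : ℕ :=
  match s.phase with
  | Phase.home => 0
  | Phase.out => 1
  | _ => 2

/-- The measure of progress of a group within one version of its search. -/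
def progress [Fintype V] (s : GroupState V) : ℕ := 3 * s.work + s.stage

/-- The group has not yet identified the black hole. -/
def Live (s : GroupState V) : Prop := s.phase ≠ Phase.lone ∧ s.phase ≠ Phase.done

/-- The group is split by its edge. -/
def Split (s : GroupState V) : Prop := s.phase ≠ Phase.home

/-- With every refused edge in `A` and no present edge in `F`, a macro round without discovery
leaves the group waiting, makes progress, or restarts for a recorded reason. Suitable sets exclude
the restart: `∅, ∅` for group `0`, and `{e}, {e}` for a group while only `e` is missing. -/
theorem next_cases [Fintype V] {P : PortGraph V} {bh : V} {A F : Set (Sym2 V)} {s : GroupState V}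
    (hdeg : ∀ x, 0 < P.deg x) {g : Fin 3} {r : ℕ} {D : Prop} {H : SimpleGraph V}
    (h : s.Inv P bh A F) (hH : ∀ e ∈ H.edgeSet, e ∉ F)
    (hsw : s.phase = Phase.swapped → s.far P ≠ bh)
    (hA : s.phase = Phase.home → g ≠ 0 → IsTurn g r → (D ∨ ¬ H.Adj s.loc (s.far P)) →
      s.edge P ∈ A)
    (hl : (s.next P bh g r D H).Live) :
    (s.next P bh g r D H = s ∧ (s.phase = Phase.home → g ≠ 0 → ¬ IsTurn g r) ∧
      ((s.phase = Phase.home → g = 0) → ¬ H.Adj s.loc (s.far P))) ∨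
    ((s.next P bh g r D H).Inv P bh A F ∧ (s.next P bh g r D H).ver = s.ver ∧
      s.progress < (s.next P bh g r D H).progress) ∨
    (Restarts P bh s (s.next P bh g r D H) ∧
      (Complete P bh A F ∨ s.edge P ∈ A ∧ s.edge P ∉ F)) := by
  classical
  rcases hs : s.phase with _ | _ | _ | _ | _
  · unfold next at hl ⊢
    rw [hs] at hl ⊢
    by_cases h1 : (g = 0 ∨ IsTurn g r ∧ ¬ D) ∧ H.Adj s.loc (s.far P)
    · simp only [if_pos h1]
      refine Or.inr (Or.inl ⟨h, trivial, ?_⟩)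
      simp only [progress, stage, hs, work]
      omega
    · simp only [if_neg h1]
      by_cases h2 : g ≠ 0 ∧ IsTurn g r
      · simp only [if_pos h2]
        have hA' := hA hs h2.1 h2.2 (by
          by_contra hc
          push Not at hc
          exact h1 ⟨Or.inr ⟨h2.2, hc.1⟩, hc.2⟩)
        rcases refused_progress hdeg h hA' with ⟨h3, h4, h5⟩ | ⟨h3, h4⟩
        · refine Or.inr (Or.inl ⟨h3, h4, ?_⟩)
          simp only [progress, stage, hs]
          omega
        · exact Or.inr (Or.inr ⟨h3, h4.imp_right fun h5 => ⟨hA', h5⟩⟩)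
      · simp only [if_neg h2]
        refine Or.inl ⟨trivial, fun _ h3 h4 => h2 ⟨h3, h4⟩, fun h3 h4 => h1 ⟨Or.inl (h3 trivial), h4⟩⟩
  · unfold next at hl ⊢
    rw [hs] at hl ⊢
    by_cases h1 : H.Adj s.loc (s.far P)
    · simp only [if_pos h1]
      refine Or.inr (Or.inl ⟨h, trivial, ?_⟩)
      simp only [progress, stage, hs, work]
      split_ifs <;> simp
    · simp only [if_neg h1]
      exact Or.inl ⟨trivial, by simp, fun _ => h1⟩
  · unfold next at hl ⊢
    rw [hs] at hl ⊢
    by_cases h1 : H.Adj s.loc (s.far P)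
    · simp only [if_pos h1]
      rcases landed_progress hdeg h (hH _ h1) (hsw hs) with ⟨h3, h4, h5⟩ | ⟨h3, h4⟩
      · refine Or.inr (Or.inl ⟨h3, h4, ?_⟩)
        simp only [progress, stage, hs]
        omega
      · exact Or.inr (Or.inr ⟨h3, Or.inl h4⟩)
    · simp only [if_neg h1]
      exact Or.inl ⟨trivial, by simp, fun _ => h1⟩
  · unfold next at hl
    rw [hs] at hl
    exact absurd rfl hl.2
  · unfold next at hl
    rw [hs] at hl
    exact absurd hs hl.2

/-- The invariant of a group, with the meaning of the stages of a crossing. -/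
structure Valid (P : PortGraph V) (bh : V) (s : GroupState V) : Prop where
  inv : s.Inv P bh Set.univ ∅
  far_ne : s.phase = Phase.swapped → s.far P ≠ bh
  far_eq : ¬ s.Live → s.far P = bh

/-- For `A = univ` and `F = ∅` the conditions on refused and crossed edges are void, so this weak
invariant survives every adversary. -/
theorem Valid.next [Fintype V] {P : PortGraph V} {bh : V} {s : GroupState V}
    (hdeg : ∀ x, 0 < P.deg x) (g : Fin 3) (r : ℕ) (D : Prop) (H : SimpleGraph V)
    (h : s.Valid P bh) : (s.next P bh g r D H).Valid P bh := by
  classical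
  have settled : ∀ {t : GroupState V}, t.phase = Phase.home →
      Advances P bh Set.univ ∅ s t ∨ Restarts P bh s t → t.Valid P bh := by
    intro t ht h
    refine ⟨?_, by simp [ht], by simp [Live, ht]⟩
    rcases h with h | h
    · exact h.1
    · exact h.2 _ _
  rcases hs : s.phase with _ | _ | _ | _ | _
  · unfold GroupState.next
    rw [hs]
    dsimp only
    split_ifs
    · exact ⟨h.inv, by simp, by simp [Live]⟩
    · exact settled rfl ((refused_progress hdeg h.inv (Set.mem_univ _)).imp_right And.left)
    · exact h
  · unfold GroupState.next
    rw [hs]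
    dsimp only
    split_ifs with h1 h2
    · exact ⟨h.inv, by simp, fun _ => h2⟩
    · exact ⟨h.inv, fun _ => h2, by simp [Live]⟩
    · exact h
  · unfold GroupState.next
    rw [hs]
    dsimp only
    split_ifs with h1
    · exact settled rfl ((landed_progress hdeg h.inv (Set.notMem_empty _)
        (h.far_ne hs)).imp_right And.left)
    · exact h
  · unfold GroupState.next
    rw [hs]
    exact ⟨h.inv, by simp, fun _ => h.far_eq (by simp [Live, hs])⟩
  · unfold GroupState.next
    rw [hs]
    exact h

/-- A group that is split after the round has taken no new decision, so its edge is the old one. If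
it was not split before, it has just begun to cross, for which the edge must have been present. -/
theorem split_of_split_next {P : PortGraph V} {bh : V} {s : GroupState V} {g : Fin 3} {r : ℕ}
    {D : Prop} {H : SimpleGraph V} (h : (s.next P bh g r D H).Split) :
    (s.next P bh g r D H).edge P = s.edge P ∧
      (s.Split ∨ (g = 0 ∨ IsTurn g r ∧ ¬ D) ∧ H.Adj s.loc (s.far P) ∧
        (s.next P bh g r D H).phase = Phase.out) := by
  classical
  rcases hs : s.phase with _ | _ | _ | _ | _
  · unfold GroupState.next at h ⊢
    rw [hs] at h ⊢
    dsimp only at h ⊢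
    split_ifs at h ⊢ with h1 h2
    · exact ⟨rfl, Or.inr ⟨h1.1, h1.2, rfl⟩⟩
    · exact absurd rfl h
    · exact absurd hs h
  · refine ⟨?_, Or.inl (by simp [Split, hs])⟩
    unfold GroupState.next
    rw [hs]
    dsimp only
    split_ifs <;> rfl
  · refine ⟨?_, Or.inl (by simp [Split, hs])⟩
    unfold GroupState.next at h ⊢
    rw [hs] at h ⊢
    dsimp only at h ⊢
    split_ifs at h ⊢
    · exact absurd rfl h
    · rfl
  · refine ⟨?_, Or.inl (by simp [Split, hs])⟩
    unfold GroupState.next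
    rw [hs]
    rfl
  · refine ⟨?_, Or.inl (by simp [Split, hs])⟩
    unfold GroupState.next
    rw [hs]

theorem next_of_swapped {P : PortGraph V} {bh : V} {s : GroupState V} {g : Fin 3} {r : ℕ}
    {D : Prop} {H : SimpleGraph V} (h : s.phase = Phase.swapped) (hadj : H.Adj s.loc (s.far P)) :
    ¬ (s.next P bh g r D H).Split := by
  unfold GroupState.next
  rw [h]
  simp [hadj, Split, landed, settle]

theorem next_of_out {P : PortGraph V} {bh : V} {s : GroupState V} {g : Fin 3} {r : ℕ}
    {D : Prop} {H : SimpleGraph V} (h : s.phase = Phase.out) (hadj : H.Adj s.loc (s.far P))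
    (hl : (s.next P bh g r D H).Live) : (s.next P bh g r D H).phase = Phase.swapped := by
  unfold GroupState.next at hl ⊢
  rw [h] at hl ⊢
  dsimp only at hl ⊢
  rw [if_pos hadj] at hl ⊢
  dsimp only [Live] at hl ⊢
  split_ifs at hl ⊢
  · exact absurd rfl hl.1
  · rfl

/-- The state of each group after round `0`. -/
noncomputable def start (root : V) : GroupState V :=
  settle ⟨root, 0, false, 0, fun _ => ⟨0, 0, 0⟩, Phase.home⟩ root (Nav.restart 0)

/-- The group `s'` is split by the edge that `s` wants to cross. -/
def Blocks (P : PortGraph V) (s s' : GroupState V) : Prop :=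
  s'.Split ∧ (s'.loc = s.loc ∧ s'.port = s.port ∨ s'.far P = s.loc ∧ s'.ent P = s.port)

/-- Group `g` may not start a crossing because of another group. -/
def Denied (P : PortGraph V) (S : Fin 3 → GroupState V) (g : Fin 3) : Prop :=
  ∃ h, h ≠ 0 ∧ h ≠ g ∧ (S g).Blocks P (S h)

end GroupState

open GroupState

variable {V : Type*}

/-- The states of the groups; `K r` is the graph present in the move round of macro round `r`. -/
noncomputable def groupRun (P : PortGraph V) (bh root : V) (K : ℕ → SimpleGraph V) :
    ℕ → Fin 3 → GroupState V
  | 0, _ => start root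
  | r + 1, g => (groupRun P bh root K r g).next P bh g r (Denied P (groupRun P bh root K r) g) (K r)

section Run

variable (P : PortGraph V) (bh root : V) (K : ℕ → SimpleGraph V)

variable {P bh root K}

local notation "S" => groupRun P bh root K

theorem groupRun_valid [Fintype V] (hdeg : ∀ x, 0 < P.deg x) (hroot : root ≠ bh) (r : ℕ)
    (g : Fin 3) : (S r g).Valid P bh := by
  induction r with
  | zero =>
    exact ⟨inv_settle_restart hdeg (fun _ => le_rfl) hroot _ _, by simp [groupRun, start, settle],
      by simp [groupRun, start, settle, Live]⟩
  | succ r ih => exact ih.next hdeg g r _ _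

/-- An edge appears at each of its ends as a pair of a node and a port, so a test that an agent can
make locally amounts to equality of edges. -/
theorem blocks_iff {s s' : GroupState V} (h : s.port < P.deg s.loc)
    (h' : s'.port < P.deg s'.loc) : s.Blocks P s' ↔ s'.Split ∧ s'.edge P = s.edge P := by
  have := PortGraph.edge_eq_iff h h'
  rw [Blocks, eq_comm (a := s'.edge P), edge, edge, far, far, this, ent,
    eq_comm (a := s.loc), eq_comm (a := s.port)]

/-- Groups `1` and `2` are never split by the same edge. -/
theorem groupRun_exclusive [Fintype V] (hdeg : ∀ x, 0 < P.deg x) (hroot : root ≠ bh) (r : ℕ) :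
    ¬ ((S r 1).Split ∧ (S r 2).Split ∧ (S r 1).edge P = (S r 2).edge P) := by
  induction r with
  | zero => rintro ⟨h, -⟩; exact h rfl
  | succ r ih =>
    rintro ⟨h1, h2, h3⟩
    have hb : ∀ g h, (S r g).Blocks P (S r h) ↔ _ := fun g h =>
      blocks_iff (groupRun_valid hdeg hroot r g).inv.1 (groupRun_valid hdeg hroot r h).inv.1
    obtain ⟨e1, s1⟩ := split_of_split_next h1
    obtain ⟨e2, s2⟩ := split_of_split_next h2
    have h4 : (S r 1).edge P = (S r 2).edge P := by rw [← e1, ← e2]; exact h3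
    -- Either both groups were split before, or the later one was denied, or both started at once,
    -- which the turns forbid.
    rcases s1 with s1 | ⟨s1, -⟩ <;> rcases s2 with s2 | ⟨s2, -⟩
    · exact ih ⟨s1, s2, h4⟩
    · exact (s2.resolve_left (by decide)).2 ⟨1, by decide, by decide, (hb 2 1).2 ⟨s1, h4⟩⟩
    · exact (s1.resolve_left (by decide)).2 ⟨2, by decide, by decide, (hb 1 2).2 ⟨s2, h4.symm⟩⟩
    · have a1 := (s1.resolve_left (by decide)).1
      have a2 := (s2.resolve_left (by decide)).1
      simp only [IsTurn] at a1 a2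
      simp at a1 a2
      omega

end Run

end BHS

/-! ### Periods in which one edge stays missing -/

namespace BHS

open GroupState

section Period

theorem adj_iff_of_missing {V : Type*} {G H : SimpleGraph V} (hle : H ≤ G)
    (hcard : (G.edgeSet \ H.edgeSet).encard ≤ 1) {e : Sym2 V} (he : e ∈ G.edgeSet)
    (he' : e ∉ H.edgeSet) (x y : V) : H.Adj x y ↔ G.Adj x y ∧ s(x, y) ≠ e := by
  constructor
  · exact fun h => ⟨hle h, fun h2 => he' (h2 ▸ h)⟩
  · rintro ⟨h1, h2⟩
    by_contra h3
    exact h2 (Set.encard_le_one_iff.1 hcard _ _ ⟨h1, h3⟩ ⟨he, he'⟩)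

variable {V : Type*}

/-- The edge `e`, and no other, is missing in the macro rounds from `a` to `b`, and no group has
identified the black hole by then. -/
structure Period (P : PortGraph V) (bh root : V) (K : ℕ → SimpleGraph V) (e : Sym2 V) (a b : ℕ) :
    Prop where
  adj : ∀ r, a ≤ r → r < b → ∀ x y, (K r).Adj x y ↔ P.graph.Adj x y ∧ s(x, y) ≠ e
  connected : ∀ r, (K r).Connected
  le : ∀ r, K r ≤ P.graph
  live : ∀ r ≤ b, ∀ g, (groupRun P bh root K r g).Live
  deg_pos : ∀ x, 0 < P.deg x
  root_ne : root ≠ bh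

/-- Group `h` is not in the middle of a crossing, except of a crossing of `e`, or of one that it has
begun on time. -/
def OnTime (P : PortGraph V) (e : Sym2 V) (h : Fin 3) (r : ℕ) (s : GroupState V) : Prop :=
  s.phase = Phase.home ∨ s.edge P = e ∨ s.phase = Phase.out ∧ r % 9 = 3 * h.val + 1 ∨
    s.phase = Phase.swapped ∧ r % 9 = (3 * h.val + 2) % 9

variable {P : PortGraph V} {bh root : V} {K : ℕ → SimpleGraph V}

local notation "S" => groupRun P bh root K

variable [Fintype V] {e : Sym2 V} {a b : ℕ}

theorem Period.adj_iff (hP : Period P bh root K e a b) {r : ℕ} (ha : a ≤ r) (hb : r < b)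
    (g : Fin 3) : (K r).Adj (S r g).loc ((S r g).far P) ↔ (S r g).edge P ≠ e := by
  rw [hP.adj r ha hb]
  exact and_iff_right
    (PortGraph.adj_far (groupRun_valid hP.deg_pos hP.root_ne r g).inv.1)

/-- A crossing of an edge other than `e` is never delayed, so once begun at a turn it occupies the
macro rounds `3h`, `3h + 1`, `3h + 2` modulo `9`. -/
theorem Period.onTime_succ (hP : Period P bh root K e a b) {r : ℕ} (ha : a ≤ r) (hb : r < b)
    {h : Fin 3} (hh : h ≠ 0) (ht : OnTime P e h r (S r h)) : OnTime P e h (r + 1) (S (r + 1) h) := by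
  have hadj := hP.adj_iff ha hb h
  have hh' : h.val = 1 ∨ h.val = 2 := by
    have := h.2
    have : h.val ≠ 0 := fun h0 => hh (Fin.ext h0)
    omega
  by_cases hs : (S (r + 1) h).Split
  swap
  · exact Or.inl (not_not.1 hs)
  obtain ⟨he, hs'⟩ := split_of_split_next hs
  by_cases hee : (S r h).edge P = e
  · exact Or.inr (Or.inl (he.trans hee))
  have hl : (S (r + 1) h).Live := hP.live _ hb h
  rcases ht with ht | ht | ⟨ht, hr⟩ | ⟨ht, hr⟩
  · have h2 := hs'.resolve_left (fun h => h ht)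
    have h3 : r % 9 = 3 * h.val := (h2.1.resolve_left hh).1
    exact Or.inr (Or.inr (Or.inl ⟨h2.2.2, by omega⟩))
  · exact absurd ht hee
  · exact Or.inr (Or.inr (Or.inr ⟨next_of_out ht (hadj.2 hee) hl, by omega⟩))
  · exact absurd hs (next_of_swapped ht (hadj.2 hee))

/-- A crossing begun before the period may be out of step, but unless its edge is `e` it is over
after two macro rounds; from then on timeliness is preserved. -/
theorem Period.onTime (hP : Period P bh root K e a b) (hab : a + 2 ≤ b) {h : Fin 3} (hh : h ≠ 0)
    {r : ℕ} (ha : a + 2 ≤ r) (hb : r ≤ b) : OnTime P e h r (S r h) := by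
  have key : ∃ r', a ≤ r' ∧ r' ≤ a + 2 ∧ OnTime P e h r' (S r' h) := by
    by_cases hee : (S a h).edge P = e
    · exact ⟨a, le_rfl, by omega, Or.inr (Or.inl hee)⟩
    have hadj := (hP.adj_iff le_rfl (by omega) h).2 hee
    have hl := hP.live a (by omega) h
    have hl1 := hP.live (a + 1) (by omega) h
    rcases hs : (S a h).phase with _ | _ | _ | _ | _
    · exact ⟨a, le_rfl, by omega, Or.inl hs⟩
    · have h1 : (S (a + 1) h).phase = Phase.swapped := next_of_out hs hadj hl1
      have h2 : (S (a + 1) h).Split := by rw [Split, h1]; simp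
      obtain ⟨he, -⟩ := split_of_split_next h2
      have hadj1 := (hP.adj_iff (r := a + 1) (by omega) (by omega) h).2
        (fun h => hee (he.symm.trans h))
      exact ⟨a + 2, by omega, le_rfl, Or.inl (not_not.1 (next_of_swapped h1 hadj1))⟩
    · exact ⟨a + 1, by omega, by omega, Or.inl (not_not.1 (next_of_swapped hs hadj))⟩
    · exact absurd hs hl.1
    · exact absurd hs hl.2
  obtain ⟨r', h1, h2, h3⟩ := key
  have : ∀ n, r' + n ≤ b → OnTime P e h (r' + n) (S (r' + n) h) := by
    intro n
    induction n with
    | zero => exact fun _ => h3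
    | succ n ih => exact fun hn => hP.onTime_succ (r := r' + n) (by omega) (by omega) hh (ih (by omega))
  have := this (r - r') (by omega)
  rwa [Nat.add_sub_cancel' (by omega)] at this

/-- A group that has its turn gives up crossing an edge only if the edge is `e`. -/
theorem Period.edge_eq (hP : Period P bh root K e a b) {r : ℕ} (ha : a + 2 ≤ r) (hb : r < b)
    {g : Fin 3} (hg : g ≠ 0) (ht : IsTurn g r)
    (hD : Denied P (S r) g ∨ ¬ (K r).Adj (S r g).loc ((S r g).far P)) : (S r g).edge P = e := by
  rcases hD with ⟨h, hh, hne, hD⟩ | hD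
  · have hv := fun g => (groupRun_valid (K := K) hP.deg_pos hP.root_ne r g).inv.1
    obtain ⟨h1, h2⟩ := (blocks_iff (hv g) (hv h)).1 hD
    rw [← h2]
    have hg' : g.val ≠ 0 := fun h0 => hg (Fin.ext h0)
    have hh' : h.val ≠ 0 := fun h0 => hh (Fin.ext h0)
    have hne' : h.val ≠ g.val := fun h0 => hne (Fin.ext h0)
    have := g.2
    have := h.2
    simp only [IsTurn] at ht
    -- A group split by a timely crossing is so at residues `1` and `2` modulo `3`, whereas turns
    -- have residue `0`.
    rcases hP.onTime (by omega) hh ha hb.le with h3 | h3 | ⟨-, h3⟩ | ⟨-, h3⟩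
    · exact absurd h3 h1
    · exact h3
    · omega
    · omega
  · by_contra hne
    exact hD ((hP.adj_iff (by omega) hb g).2 hne)

theorem Period.next_cases (hP : Period P bh root K e a b) {A F : Set (Sym2 V)} {g : Fin 3} {r : ℕ}
    (hb : r < b) (h : (S r g).Inv P bh A F) (hH : ∀ x ∈ (K r).edgeSet, x ∉ F)
    (hA : g ≠ 0 → IsTurn g r → (Denied P (S r) g ∨ ¬ (K r).Adj (S r g).loc ((S r g).far P)) →
      (S r g).edge P ∈ A) :
    (S (r + 1) g = S r g ∧ ((S r g).phase = Phase.home → g ≠ 0 → ¬ IsTurn g r) ∧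
      (((S r g).phase = Phase.home → g = 0) → ¬ (K r).Adj (S r g).loc ((S r g).far P))) ∨
    ((S (r + 1) g).Inv P bh A F ∧ (S (r + 1) g).ver = (S r g).ver ∧
      (S r g).progress < (S (r + 1) g).progress) ∨
    (Restarts P bh (S r g) (S (r + 1) g) ∧
      (Complete P bh A F ∨ (S r g).edge P ∈ A ∧ (S r g).edge P ∉ F)) :=
  GroupState.next_cases hP.deg_pos h hH
    (groupRun_valid hP.deg_pos hP.root_ne r g).far_ne (fun _ => hA) (hP.live (r + 1) hb g)

theorem Period.next_cases_univ (hP : Period P bh root K e a b) {r : ℕ} (hb : r < b) (g : Fin 3) :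
    (S (r + 1) g = S r g ∧ ((S r g).phase = Phase.home → g ≠ 0 → ¬ IsTurn g r) ∧
      (((S r g).phase = Phase.home → g = 0) → ¬ (K r).Adj (S r g).loc ((S r g).far P))) ∨
    ((S (r + 1) g).Inv P bh Set.univ ∅ ∧ (S (r + 1) g).ver = (S r g).ver ∧
      (S r g).progress < (S (r + 1) g).progress) ∨
    (Restarts P bh (S r g) (S (r + 1) g) ∧ (Complete P bh Set.univ ∅ ∨
      (S r g).edge P ∈ Set.univ ∧ (S r g).edge P ∉ (∅ : Set (Sym2 V)))) :=
  hP.next_cases (A := Set.univ) (F := ∅) hb (groupRun_valid hP.deg_pos hP.root_ne r g).inv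
    (by simp) (by simp)

/-- A group that is not split by `e` at the beginning will not be split by `e`. -/
theorem Period.not_split (hP : Period P bh root K e a b) {g : Fin 3}
    (hg : ¬ ((S a g).Split ∧ (S a g).edge P = e)) {r : ℕ} (ha : a ≤ r) (hb : r ≤ b) :
    ¬ ((S r g).Split ∧ (S r g).edge P = e) := by
  induction r, ha using Nat.le_induction with
  | base => exact hg
  | succ r ha ih =>
    rintro ⟨h1, h2⟩
    obtain ⟨h3, h4⟩ := split_of_split_next h1
    have h5 : (S r g).edge P = e := h3.symm.trans h2
    rcases h4 with h4 | ⟨-, h4, -⟩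
    · exact ih (by omega) ⟨h4, h5⟩
    · exact (hP.adj_iff ha (by omega) g).1 h4 h5

/-- The work is at most `9|E|`, and `3 * 9|E| + 2 < 30|E|`. -/
theorem progress_lt {s : GroupState V} {A F : Set (Sym2 V)} (h : s.Inv P bh A F)
    (hc : P.graph.Connected) (hE : 1 ≤ P.numEdges) : s.progress < 30 * P.numEdges := by
  have h1 := h.work_le hc hE
  have h2 : s.stage ≤ 2 := by
    unfold stage
    split <;> omega
  unfold progress
  omega

variable (hP : Period P bh root K e a b) (hc : P.graph.Connected) (hE : 1 ≤ P.numEdges)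
  {g : Fin 3}
include hP hc hE

/-- The version acts as the leading digit in base `30|E|`, so that a restart is an increase as well.
-/
theorem Period.measure_succ {r : ℕ} (hb : r < b) :
    S (r + 1) g = S r g ∧ ((S r g).phase = Phase.home → g ≠ 0 → ¬ IsTurn g r) ∧
      (((S r g).phase = Phase.home → g = 0) → ¬ (K r).Adj (S r g).loc ((S r g).far P)) ∨
    (S r g).ver * (30 * P.numEdges) + (S r g).progress <
      (S (r + 1) g).ver * (30 * P.numEdges) + (S (r + 1) g).progress := by
  rcases hP.next_cases_univ hb g with h | ⟨-, h1, h2⟩ | ⟨⟨h1, -⟩, -⟩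
  · exact Or.inl h
  · right; rw [h1]; omega
  · right
    have := progress_lt (groupRun_valid (K := K) hP.deg_pos hP.root_ne r g).inv hc hE
    rw [h1, add_mul]
    omega

/-- Without an increase the state is frozen for nine macro rounds. If the group is split, it waits
for `e`, which is excluded; otherwise its turn falls into these rounds and forces a start or a
refusal. -/
theorem Period.measure_nine (hg0 : g ≠ 0) (hg : ¬ ((S a g).Split ∧ (S a g).edge P = e)) {r : ℕ}
    (ha : a ≤ r) (hb : r + 9 ≤ b) :
    (S r g).ver * (30 * P.numEdges) + (S r g).progress <
      (S (r + 9) g).ver * (30 * P.numEdges) + (S (r + 9) g).progress := by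
  by_contra hcon
  have hmono : ∀ i, i ≤ 9 → (S r g).ver * (30 * P.numEdges) + (S r g).progress ≤
      (S (r + i) g).ver * (30 * P.numEdges) + (S (r + i) g).progress := by
    intro i
    induction i with
    | zero => exact fun _ => le_rfl
    | succ i ih =>
      intro hi
      refine (ih (by omega)).trans ?_
      rcases hP.measure_succ hc hE (g := g) (r := r + i) (by omega) with ⟨h, -⟩ | h
      · rw [← add_assoc, h]
      · exact h.le
  have hanti : ∀ i, i ≤ 9 → (S (r + (9 - i)) g).ver * (30 * P.numEdges) +
      (S (r + (9 - i)) g).progress ≤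
        (S (r + 9) g).ver * (30 * P.numEdges) + (S (r + 9) g).progress := by
    intro i
    induction i with
    | zero => exact fun _ => le_rfl
    | succ i ih =>
      intro hi
      refine le_trans ?_ (ih (by omega))
      have h9 : r + (9 - i) = r + (9 - (i + 1)) + 1 := by omega
      rw [h9]
      rcases hP.measure_succ hc hE (g := g) (r := r + (9 - (i + 1))) (by omega) with ⟨h, -⟩ | h
      · rw [h]
      · exact h.le
  have hstay : ∀ i < 9, S (r + i + 1) g = S (r + i) g ∧
      ((S (r + i) g).phase = Phase.home → g ≠ 0 → ¬ IsTurn g (r + i)) ∧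
      (((S (r + i) g).phase = Phase.home → g = 0) →
        ¬ (K (r + i)).Adj (S (r + i) g).loc ((S (r + i) g).far P)) := by
    intro i hi
    refine (hP.measure_succ hc hE (g := g) (r := r + i) (by omega)).resolve_right fun h => ?_
    have h1 := hmono i (by omega)
    have h2 := hanti (9 - (i + 1)) (by omega)
    rw [show 9 - (9 - (i + 1)) = i + 1 by omega, ← add_assoc] at h2
    omega
  have heq : ∀ i ≤ 9, S (r + i) g = S r g := by
    intro i
    induction i with
    | zero => exact fun _ => rfl
    | succ i ih => exact fun hi => (hstay i hi).1.trans (ih (by omega))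
  by_cases hs : (S r g).Split
  · have h1 := (hstay 0 (by omega)).2.2 (fun h => absurd h hs)
    rw [add_zero, hP.adj_iff ha (by omega), not_not] at h1
    exact hP.not_split hg ha (by omega) ⟨hs, h1⟩
  · have hlt := g.2
    obtain ⟨i, hi, ht⟩ : ∃ i < 9, IsTurn g (r + i) := by
      refine ⟨(3 * g.val + 9 - r % 9) % 9, Nat.mod_lt _ (by omega), ?_⟩
      simp only [IsTurn]
      omega
    exact (hstay i hi).2.1 (by rw [heq i hi.le]; exact not_not.1 hs) hg0 ht

/-- Within a single version, one unit per nine macro rounds would lift the progress to its strict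
upper bound `30|E|`. -/
theorem Period.ver_ne (hg0 : g ≠ 0) (hg : ¬ ((S a g).Split ∧ (S a g).edge P = e)) {r : ℕ}
    (ha : a ≤ r) (hb : r + 9 * (30 * P.numEdges) ≤ b) :
    (S (r + 9 * (30 * P.numEdges)) g).ver ≠ (S r g).ver := by
  have h : ∀ n, r + 9 * n ≤ b → (S r g).ver * (30 * P.numEdges) + (S r g).progress + n ≤
      (S (r + 9 * n) g).ver * (30 * P.numEdges) + (S (r + 9 * n) g).progress := by
    intro n
    induction n with
    | zero => exact fun _ => le_rfl
    | succ n ih =>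
      intro hn
      have h1 := ih (by omega)
      have h2 := hP.measure_nine hc hE hg0 hg (r := r + 9 * n) (by omega) (by omega)
      rw [show r + 9 * (n + 1) = r + 9 * n + 9 by ring]
      omega
  intro heq
  have h1 := h _ hb
  rw [heq] at h1
  have := progress_lt (groupRun_valid (K := K) hP.deg_pos hP.root_ne
    (r + 9 * (30 * P.numEdges)) g).inv hc hE
  omega

/-- After the `2` macro rounds needed by `Period.onTime`, the first half of the time forces a
restart. The new search satisfies the invariant with `A = F = {e}`, which prevents any further
restart, but the second half forces one. -/
theorem Period.false_of_not_split (hg0 : g ≠ 0) (hg : ¬ ((S a g).Split ∧ (S a g).edge P = e))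
    (hb : a + 2 + 18 * (30 * P.numEdges) ≤ b) : False := by
  obtain ⟨r, hr1, hr2, hr3⟩ : ∃ r, a + 2 ≤ r ∧ r < a + 2 + 9 * (30 * P.numEdges) ∧
      (S (r + 1) g).ver ≠ (S r g).ver := by
    by_contra hcon
    push Not at hcon
    refine hP.ver_ne hc hE hg0 hg (r := a + 2) (by omega) (by omega) ?_
    have : ∀ n ≤ 9 * (30 * P.numEdges), (S (a + 2 + n) g).ver = (S (a + 2) g).ver := by
      intro n
      induction n with
      | zero => exact fun _ => rfl
      | succ n ih =>
        exact fun hn => (hcon (a + 2 + n) (by omega) (by omega)).trans (ih (by omega))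
    exact this _ le_rfl
  have hinv : (S (r + 1) g).Inv P bh {e} {e} := by
    rcases hP.next_cases_univ (r := r) (by omega) g with ⟨h, -⟩ | ⟨-, h, -⟩ | ⟨⟨-, h⟩, -⟩
    · exact absurd (by rw [h]) hr3
    · exact absurd h hr3
    · exact h _ _
  have key : ∀ n, r + 1 + n ≤ b → (S (r + 1 + n) g).Inv P bh {e} {e} ∧
      (S (r + 1 + n) g).ver = (S (r + 1) g).ver := by
    intro n
    induction n with
    | zero => exact fun _ => ⟨hinv, rfl⟩
    | succ n ih =>
      intro hn
      obtain ⟨ih1, ih2⟩ := ih (by omega)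
      have hK : ∀ x ∈ (K (r + 1 + n)).edgeSet, x ∉ ({e} : Set (Sym2 V)) := by
        intro x
        induction x with | _ x y
        exact fun hx => ((hP.adj (r + 1 + n) (by omega) (by omega) x y).1 hx).2
      -- A restart would require a completed search in the connected graph without `e`, or a refused
      -- step back over an edge that both is and is not `e`.
      rcases hP.next_cases (r := r + 1 + n) (by omega) ih1 hK
        (fun h1 h2 h3 => hP.edge_eq (by omega) (by omega) h1 h2 h3) with
        ⟨h, -⟩ | ⟨h1, h2, -⟩ | ⟨-, h | h⟩
      · rw [← add_assoc, h]; exact ⟨ih1, ih2⟩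
      · exact ⟨h1, h2.trans ih2⟩
      · obtain ⟨ver, sl, u, h1, h2, h3⟩ := h
        exact (h1.not_complete h2 h3 (hP.connected (r + 1 + n)) (hP.le _) hK).elim
      · exact absurd h.1 h.2
  exact hP.ver_ne hc hE hg0 hg (r := r + 1) (by omega) (by omega) (key _ (by omega)).2

/-- Exclusiveness leaves one of the groups `1` and `2` that is not split by `e` when the period
begins. -/
theorem Period.false (hb : a + 2 + 18 * (30 * P.numEdges) ≤ b) : False := by
  by_cases h1 : (S a 1).Split ∧ (S a 1).edge P = e
  · by_cases h2 : (S a 2).Split ∧ (S a 2).edge P = e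
    · exact groupRun_exclusive hP.deg_pos hP.root_ne a ⟨h1.1, h2.1, h1.2.trans h2.2.symm⟩
    · exact hP.false_of_not_split hc hE (by decide) h2 hb
  · exact hP.false_of_not_split hc hE (by decide) h1 hb

end Period

/-! ### The quadratic time bound -/

section Time

variable {V : Type*} [Fintype V] {P : PortGraph V} {bh root : V} {K : ℕ → SimpleGraph V}

local notation "S" => groupRun P bh root K

theorem exists_done (hadm : ∀ r, K r ≤ P.graph ∧ (K r).Connected ∧
    (P.graph.edgeSet \ (K r).edgeSet).encard ≤ 1) (hc : P.graph.Connected)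
    (hE : 1 ≤ P.numEdges) (hdeg : ∀ x, 0 < P.deg x) (hroot : root ≠ bh) :
    ∃ r ≤ 30 * P.numEdges * (2 + 18 * (30 * P.numEdges)) + 1, ∃ g, (S r g).phase = Phase.done := by
  by_contra hcon
  push Not at hcon
  -- The phase `lone` turns into `done` one macro round later, hence the `+ 1` in the bound.
  have live : ∀ r ≤ 30 * P.numEdges * (2 + 18 * (30 * P.numEdges)), ∀ g, (S r g).Live := by
    intro r hr g
    refine ⟨fun h => hcon (r + 1) (by omega) g ?_, hcon r (by omega) g⟩
    rw [groupRun, GroupState.next, h]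
  -- Group `0` never refuses an edge, so `A = F = ∅` works and a restart would need a completed
  -- search.
  have next0 : ∀ r < 30 * P.numEdges * (2 + 18 * (30 * P.numEdges)),
      (S r 0).Inv P bh ∅ ∅ → (S (r + 1) 0).Inv P bh ∅ ∅ ∧
      (S (r + 1) 0 = S r 0 ∧ ¬ (K r).Adj (S r 0).loc ((S r 0).far P) ∨
        (S r 0).progress < (S (r + 1) 0).progress) := by
    intro r hr h
    have := GroupState.next_cases hdeg h (g := 0) (r := r) (D := Denied P (S r) 0) (H := K r)
      (by simp) (groupRun_valid hdeg hroot r 0).far_ne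
      (by simp) (live (r + 1) hr 0)
    rcases this with ⟨h1, -, h2⟩ | ⟨h1, -, h2⟩ | ⟨-, h1 | h1⟩
    · replace h1 : S (r + 1) 0 = S r 0 := h1
      exact ⟨h1 ▸ h, Or.inl ⟨h1, h2 fun _ => rfl⟩⟩
    · exact ⟨h1, Or.inr h2⟩
    · obtain ⟨ver, sl, u, h1, h2, h3⟩ := h1
      exact (h1.not_complete h2 h3 (hadm r).2.1 (hadm r).1 (by simp)).elim
    · exact absurd h1.1 (Set.notMem_empty _)
  have inv0 : ∀ r ≤ 30 * P.numEdges * (2 + 18 * (30 * P.numEdges)), (S r 0).Inv P bh ∅ ∅ := by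
    intro r
    induction r with
    | zero => exact fun _ => inv_settle_restart hdeg (fun _ => le_rfl) hroot _ _
    | succ r ih => exact fun hr => (next0 r hr (ih (by omega))).1
  have window : ∀ a, a + (2 + 18 * (30 * P.numEdges)) ≤
      30 * P.numEdges * (2 + 18 * (30 * P.numEdges)) →
      (S a 0).progress < (S (a + (2 + 18 * (30 * P.numEdges))) 0).progress := by
    intro a ha
    by_contra hlt
    have mono : ∀ r r', r ≤ r' → r' ≤ 30 * P.numEdges * (2 + 18 * (30 * P.numEdges)) →
        (S r 0).progress ≤ (S r' 0).progress := by
      intro r r' h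
      induction r', h using Nat.le_induction with
      | base => exact fun _ => le_rfl
      | succ r' h ih =>
        intro hr
        refine (ih (by omega)).trans ?_
        rcases (next0 r' hr (inv0 r' (by omega))).2 with ⟨h, -⟩ | h
        · rw [h]
        · exact h.le
    have stay : ∀ r, a ≤ r → r < a + (2 + 18 * (30 * P.numEdges)) →
        S (r + 1) 0 = S r 0 ∧ ¬ (K r).Adj (S r 0).loc ((S r 0).far P) := by
      intro r h1 h2
      refine (next0 r (by omega) (inv0 r (by omega))).2.resolve_right fun h => ?_
      have h3 := mono a r h1 (by omega)
      have h4 := mono (r + 1) _ h2 ha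
      omega
    have heq : ∀ n, n ≤ 2 + 18 * (30 * P.numEdges) → S (a + n) 0 = S a 0 := by
      intro n
      induction n with
      | zero => exact fun _ => rfl
      | succ n ih =>
        exact fun hn => (stay (a + n) (by omega) (by omega)).1.trans (ih (by omega))
    -- Group `0` is stuck during the whole window, so its edge is missing throughout, and therefore
    -- no other edge ever is.
    have hP : Period P bh root K ((S a 0).edge P) a (a + (2 + 18 * (30 * P.numEdges))) := by
      refine ⟨fun r h1 h2 => ?_, fun r => (hadm r).2.1, fun r => (hadm r).1,
        fun r hr => live r (by omega), hdeg, hroot⟩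
      have h3 := (stay r h1 h2).2
      have h4 := heq (r - a) (by omega)
      rw [Nat.add_sub_cancel' h1] at h4
      rw [h4] at h3
      exact adj_iff_of_missing (hadm r).1 (hadm r).2.2
        (PortGraph.adj_far (groupRun_valid hdeg hroot a 0).inv.1) h3
    exact hP.false hc hE (by omega)
  -- Each window yields a unit of progress, so `30|E|` windows contradict `progress_lt`.
  have total : ∀ n ≤ 30 * P.numEdges, n ≤ (S (n * (2 + 18 * (30 * P.numEdges))) 0).progress := by
    intro n
    induction n with
    | zero => exact fun _ => Nat.zero_le _
    | succ n ih =>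
      intro hn
      have h1 := ih (by omega)
      have h2 := Nat.mul_le_mul_right (2 + 18 * (30 * P.numEdges)) hn
      rw [Nat.succ_mul] at h2 ⊢
      have h3 := window _ h2
      omega
  have h1 := total _ le_rfl
  have h2 := progress_lt (inv0 _ le_rfl) hc hE
  omega

end Time

end BHS

/-! ### Roles and whiteboards -/

namespace BHS

open GroupState

section Roles

variable {V : Type*} (I : Instance V 9)

/-- The number of agents with a smaller identifier. -/
def idRank (i : Fin 9) : ℕ := (Finset.univ.filter fun j => I.id j < I.id i).card

/-- The group of an agent. -/
def agentGrp (i : Fin 9) : Fin 3 := Fin.ofNat 3 (idRank I i / 3)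

/-- The role of an agent in its group. -/
def agentRole (i : Fin 9) : Fin 3 := Fin.ofNat 3 (idRank I i % 3)

variable {I} (hid : Function.Injective I.id)

theorem idRank_lt (i : Fin 9) : idRank I i < 9 := by
  have : (Finset.univ.filter fun j => I.id j < I.id i) ⊂ Finset.univ :=
    Finset.ssubset_univ_iff.2 fun h => by
      have := Finset.mem_univ i
      rw [← h] at this
      simp at this
  simpa [idRank] using Finset.card_lt_card this

include hid in
theorem idRank_injective : Function.Injective (idRank I) := by
  have key : ∀ i j, I.id i < I.id j → idRank I i < idRank I j := by
    intro i j h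
    refine Finset.card_lt_card ⟨fun x hx => ?_, fun hs => ?_⟩
    · simp only [Finset.mem_filter, Finset.mem_univ, true_and] at hx ⊢
      exact hx.trans h
    · have := hs (show i ∈ _ by simpa using h)
      simp at this
  intro i j h
  rcases lt_trichotomy (I.id i) (I.id j) with h1 | h1 | h1
  · exact absurd h (key i j h1).ne
  · exact hid h1
  · exact absurd h (key j i h1).ne'

include hid in
theorem agent_injective : Function.Injective fun i => (agentGrp I i, agentRole I i) := by
  intro i j h
  simp only [Prod.mk.injEq, agentGrp, agentRole, Fin.ext_iff, Fin.val_ofNat] at h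
  have h1 := idRank_lt (I := I) i
  have h2 := idRank_lt (I := I) j
  exact idRank_injective hid (by omega)

include hid in
theorem exists_agent (g k : Fin 3) : ∃ i, agentGrp I i = g ∧ agentRole I i = k := by
  have h := (Fintype.bijective_iff_injective_and_card _).2 ⟨agent_injective hid, by simp⟩
  obtain ⟨i, hi⟩ := h.2 (g, k)
  simp only [Prod.mk.injEq] at hi
  exact ⟨i, hi⟩

include hid in
theorem view_rank {C : Config V 9} {i : Fin 9} (h : ∀ j, C.pos j = C.pos i) :
    (view I C i).rank = idRank I i := by
  classical
  unfold View.rank view idRank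
  rw [Finset.filter_image, Finset.card_image_of_injOn]
  · congr 1
    ext j
    simp only [Finset.mem_filter, Finset.mem_univ, true_and, h j, and_true]
    exact ⟨fun h => h.2, fun h2 => ⟨fun h3 => by simp [h3] at h2, h2⟩⟩
  · intro j _ j' _ hj
    exact hid (Prod.ext_iff.1 hj).1

/-- Every agent knows its role. -/
def KnowRoles (I : Instance V 9) (C : Config V 9) : Prop :=
  ∀ i, (Mem.dec (C.mem i)).grp = agentGrp I i ∧ (Mem.dec (C.mem i)).role = agentRole I i

theorem exists_others_iff {C : Config V 9} {i : Fin 9} (p : Mem → Prop) :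
    (∃ x ∈ (view I C i).others, p (Mem.dec x.2)) ↔
      ∃ j, j ≠ i ∧ C.pos j = C.pos i ∧ p (Mem.dec (C.mem j)) := by
  classical
  simp [view, and_assoc]

-- Positions depend on group and role alone, and every pair of group and role is taken by some
-- agent; so seeing a partner means that two values of `f` coincide.
include hid in
theorem here_iff {C : Config V 9} {i : Fin 9} {m : Mem} {k : Fin 3} (hC : KnowRoles I C)
    {f : Fin 3 → Fin 3 → V} (hf : ∀ j, C.pos j = f (agentGrp I j) (agentRole I j))
    (hm : m.grp = agentGrp I i) (hk : k ≠ agentRole I i) :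
    (view I C i).Here m k ↔ f (agentGrp I i) k = f (agentGrp I i) (agentRole I i) := by
  rw [View.Here, exists_others_iff fun x => x.grp = m.grp ∧ x.role = k]
  constructor
  · rintro ⟨j, -, h2, h3, h4⟩
    rw [(hC j).1, hm] at h3
    rw [(hC j).2] at h4
    rw [hf j, hf i, h3, h4] at h2
    exact h2
  · intro h
    obtain ⟨j, h1, h2⟩ := exists_agent hid (agentGrp I i) k
    refine ⟨j, ?_, ?_, by rw [(hC j).1, h1, hm], by rw [(hC j).2, h2]⟩
    · rintro rfl; exact hk h2.symm
    · rw [hf j, hf i, h1, h2, h]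

include hid in
theorem gathered_iff {C : Config V 9} {i : Fin 9} {m : Mem} (hC : KnowRoles I C)
    {f : Fin 3 → Fin 3 → V} (hf : ∀ j, C.pos j = f (agentGrp I j) (agentRole I j))
    (hm : m.grp = agentGrp I i) (hm' : m.role = agentRole I i) :
    (view I C i).Gathered m ↔ ∀ k, f (agentGrp I i) k = f (agentGrp I i) (agentRole I i) := by
  refine forall_congr' fun k => ?_
  by_cases hk : k = agentRole I i
  · simp [hk, hm']
  · rw [here_iff hid hC hf hm hk, hm', or_iff_right hk]

end Roles

section Boards

/-- Edits of different groups touch different slots, and the edits of group `g` all write the same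
`x`, so the order of access is irrelevant. -/
theorem foldl_boards {n : ℕ} (G : Fin n → Fin 3) (upd : Fin n → Option Slot)
    (f : List Bool → Fin n → List Bool)
    (hf : ∀ b i, f b i = match upd i with
      | some x => writeSlot (G i) x b
      | none => b) (g : Fin 3) (x : Slot) (l : List (Fin n)) :
    ∀ b, (∀ i ∈ l, G i = g → upd i = none ∨ upd i = some x) →
      Board.dec (l.foldl f b) g = open Classical in
        if ∃ i ∈ l, G i = g ∧ upd i = some x then x else Board.dec b g := by
  classical
  induction l with
  | nil => intro b _; simp
  | cons i l ih =>
    intro b h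
    rw [List.foldl_cons, ih _ fun j hj => h j (List.mem_cons_of_mem _ hj), hf]
    by_cases h1 : ∃ j ∈ l, G j = g ∧ upd j = some x
    · rw [if_pos h1, if_pos]
      obtain ⟨j, hj, hj'⟩ := h1
      exact ⟨j, List.mem_cons_of_mem _ hj, hj'⟩
    · rw [if_neg h1]
      by_cases hg : G i = g
      · rcases h i (by simp) hg with h2 | h2
        · rw [h2, if_neg]
          rintro ⟨j, hj, hj'⟩
          rcases List.mem_cons.1 hj with rfl | hj
          · rw [h2] at hj'; exact absurd hj'.2 (by simp)
          · exact h1 ⟨j, hj, hj'⟩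
        · rw [h2, if_pos ⟨i, by simp, hg, h2⟩]
          simp [writeSlot, hg]
      · rw [if_neg]
        · split
          · simp [writeSlot, Ne.symm hg]
          · rfl
        · rintro ⟨j, hj, hj'⟩
          rcases List.mem_cons.1 hj with rfl | hj
          · exact hg hj'.1
          · exact h1 ⟨j, hj, hj'⟩

variable {V : Type*} {I : Instance V 9} {C : Config V 9} {A : Algorithm} {t : ℕ}

/-- The effect of a round on slot `g` of the whiteboards. -/
theorem step_board (G : Fin 9 → Fin 3) (upd : Fin 9 → Option Slot)
    (hf : ∀ i, Active I C i → ∀ b, (decision A I C i).edit b = match upd i with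
      | some x => writeSlot (G i) x b
      | none => b) (g : Fin 3) (x : Slot) (v : V)
    (hx : ∀ i, Active I C i → C.pos i = v → G i = g → upd i = none ∨ upd i = some x) :
    Board.dec ((step A I t C).board v) g = open Classical in
      if ∃ i, Active I C i ∧ C.pos i = v ∧ G i = g ∧ upd i = some x then x
      else Board.dec (C.board v) g := by
  classical
  have := foldl_boards G (fun i => if Active I C i ∧ C.pos i = v then upd i else none)
    (fun b i => if Active I C i ∧ C.pos i = v then (decision A I C i).edit b else b) (by
      intro b i
      by_cases hi : Active I C i ∧ C.pos i = v
      · simp only [if_pos hi]; exact hf i hi.1 b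
      · simp only [if_neg hi]) g x (List.ofFn (I.order t)) (C.board v) (by
      intro i _ hg
      by_cases hi : Active I C i ∧ C.pos i = v
      · simp only [if_pos hi]; exact hx i hi.1 hi.2 hg
      · simp [if_neg hi])
  simp only [step]
  convert this using 2
  constructor
  · rintro ⟨i, h1, h2, h3, h4⟩
    refine ⟨i, List.mem_ofFn.2 ⟨(I.order t).symm i, by simp⟩, h3, ?_⟩
    rw [if_pos ⟨h1, h2⟩, h4]
  · rintro ⟨i, -, h3, h4⟩
    by_cases hi : Active I C i ∧ C.pos i = v
    · rw [if_pos hi] at h4; exact ⟨i, hi.1, hi.2, h3, h4⟩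
    · rw [if_neg hi] at h4; exact absurd h4 (by simp)

end Boards

end BHS

/-! ### Refinement: move rounds -/

namespace BHS

namespace GroupState

variable {V : Type*} (P : PortGraph V) (bh : V) (s : GroupState V)

/-- The group is in the middle of a crossing. -/
def crossing : Bool :=
  match s.phase with
  | Phase.home => false
  | _ => true

/-- The member with role `k` is at the other end of the edge. -/
def atFar (k : Fin 3) : Bool :=
  match s.phase with
  | Phase.home => false
  | Phase.out => k = 0
  | Phase.swapped => k = 1
  | _ => k ≠ 2

/-- The two ends of the edge. -/
noncomputable def place (b : Bool) : V := if b then s.far P else s.loc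

/-- The ports at the two ends of the edge. -/
noncomputable def gate (b : Bool) : ℕ := if b then s.ent P else s.port

/-- The member with role `k` tries to cross the edge; `go` says that the group may start. -/
def Moves (go : Prop) (k : Fin 3) : Prop :=
  match s.phase with
  | Phase.home => k = 0 ∧ go
  | Phase.out => k = 1 ∨ k = 0 ∧ s.far P ≠ bh
  | Phase.swapped => k ≠ 1
  | _ => False

open Classical in
/-- The member with role `k` is at the other end of the edge after the move round. -/
noncomputable def midFar (go : Prop) (H : SimpleGraph V) (k : Fin 3) : Bool :=
  if s.Moves P bh go k ∧ H.Adj s.loc (s.far P) then !s.atFar k else s.atFar k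

variable {P bh s}

-- Both directions depend on the same adjacency, which is why the exchange of roles `0` and `1`
-- succeeds or fails as a whole.
open Classical in
theorem traverse_place (h : s.port < P.deg s.loc) (H : SimpleGraph V) (b : Bool) :
    traverse P H (s.place P b) (s.gate P b) = if H.Adj s.loc (s.far P) then
      (s.place P (!b), LastMove.arrived (s.gate P (!b))) else (s.place P b, LastMove.blocked) := by
  cases b
  · simpa [place, gate, far, ent] using PortGraph.traverse_eq h H
  · have h1 := PortGraph.traverse_eq (PortGraph.ent_lt h) H
    rw [PortGraph.far_far h, PortGraph.ent_ent h] at h1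
    simpa [place, gate, far, ent, H.adj_comm] using h1

theorem split_iff : s.Split ↔ s.crossing = true := by
  unfold Split crossing
  rcases s.phase <;> simp

theorem atFar_two : s.atFar 2 = false := by
  unfold atFar
  split <;> simp

theorem place_eq_iff (h : s.port < P.deg s.loc) {b b' : Bool} :
    s.place P b = s.place P b' ↔ b = b' := by
  have := PortGraph.far_ne h
  cases b <;> cases b' <;> simp [place, far, this, this.symm]

end GroupState

open GroupState

section Refinement

variable {V : Type*} (I : Instance V 9)

/-- Group `g` may start a crossing in macro round `r`. -/
def MayStart (P : PortGraph V) (Sg : Fin 3 → GroupState V) (r : ℕ) (g : Fin 3) : Prop :=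
  g = 0 ∨ IsTurn g r ∧ ¬ Denied P Sg g

/-- The configuration `C` before the move round `t` represents the states `Sg` of the groups. -/
structure Represents (t : ℕ) (C : Config V 9) (Sg : Fin 3 → GroupState V) : Prop where
  roles : KnowRoles I C
  pos : ∀ i, C.pos i = (Sg (agentGrp I i)).place I.ports ((Sg (agentGrp I i)).atFar (agentRole I i))
  ver : ∀ i, C.pos i ≠ I.bh → (Mem.dec (C.mem i)).ver = (Sg (agentGrp I i)).ver
  port : ∀ i, C.pos i ≠ I.bh → (Mem.dec (C.mem i)).port =
    (Sg (agentGrp I i)).gate I.ports ((Sg (agentGrp I i)).atFar (agentRole I i))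
  back : ∀ i, C.pos i ≠ I.bh → (Mem.dec (C.mem i)).back = (Sg (agentGrp I i)).back
  crossing : ∀ i, C.pos i ≠ I.bh → (Mem.dec (C.mem i)).crossing = (Sg (agentGrp I i)).crossing
  clock : ∀ i, C.pos i ≠ I.bh → C.claim i = none → (Mem.dec (C.mem i)).clock = t
  claim : ∀ i, C.claim i = open Classical in
    if (Sg (agentGrp I i)).phase = Phase.done ∧ agentRole I i = 2 then
      some (Sg (agentGrp I i)).port else none
  board : ∀ v g, Board.dec (C.board v) g = (Sg g).slots v

/-- The configuration `C` before the think round `t` arises from a configuration that represents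
`Sg` by the move round of macro round `r`, with the graph `H`. -/
structure Between (t : ℕ) (C : Config V 9) (Sg : Fin 3 → GroupState V) (r : ℕ)
    (H : SimpleGraph V) : Prop where
  roles : KnowRoles I C
  pos : ∀ i, C.pos i = (Sg (agentGrp I i)).place I.ports ((Sg (agentGrp I i)).midFar I.ports I.bh
    (MayStart I.ports Sg r (agentGrp I i)) H (agentRole I i))
  ver : ∀ i, C.pos i ≠ I.bh → (Mem.dec (C.mem i)).ver = (Sg (agentGrp I i)).ver
  port : ∀ i, C.pos i ≠ I.bh → (Mem.dec (C.mem i)).port =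
    (Sg (agentGrp I i)).gate I.ports ((Sg (agentGrp I i)).atFar (agentRole I i))
  back : ∀ i, C.pos i ≠ I.bh → (Mem.dec (C.mem i)).back = (Sg (agentGrp I i)).back
  crossing : ∀ i, C.pos i ≠ I.bh → (Mem.dec (C.mem i)).crossing = (Sg (agentGrp I i)).crossing
  clock : ∀ i, C.pos i ≠ I.bh → C.claim i = none → (Mem.dec (C.mem i)).clock = t
  entry : ∀ i, C.pos i ≠ I.bh → C.claim i = none → (view I C i).entry (Mem.dec (C.mem i)) =
    (Sg (agentGrp I i)).gate I.ports ((Sg (agentGrp I i)).midFar I.ports I.bh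
      (MayStart I.ports Sg r (agentGrp I i)) H (agentRole I i))
  claim : ∀ i, C.claim i = open Classical in
    if ¬ (Sg (agentGrp I i)).Live ∧ agentRole I i = 2 then
      some (Sg (agentGrp I i)).port else none
  board : ∀ v g, Board.dec (C.board v) g = (Sg g).slots v

variable {I} {t : ℕ} {C : Config V 9} {Sg : Fin 3 → GroupState V}
  (hid : Function.Injective I.id) (hv : ∀ g, (Sg g).Valid I.ports I.bh)
  (hR : Represents I t C Sg)

include hid hv hR

/-- A split group has a witness at each safe end of its edge: role `2` at the near end, and role `0`
or `1` at the far end. If the far end is the black hole, no living agent looks there. -/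
theorem Represents.denied_iff {i : Fin 9} (hi : C.pos i ≠ I.bh)
    (hp : (Sg (agentGrp I i)).phase = Phase.home) :
    (view I C i).Denied (Mem.dec (C.mem i)) ↔ Denied I.ports Sg (agentGrp I i) := by
  have hfar : (Sg (agentGrp I i)).atFar (agentRole I i) = false := by simp [atFar, hp]
  have hpos : C.pos i = (Sg (agentGrp I i)).loc := by rw [hR.pos, hfar]; rfl
  have hport : (Mem.dec (C.mem i)).port = (Sg (agentGrp I i)).port := by
    rw [hR.port i hi, hfar]; rfl
  rw [View.Denied, exists_others_iff fun x => x.crossing = true ∧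
    x.port = (Mem.dec (C.mem i)).port ∧ x.grp ≠ 0 ∧ x.grp ≠ (Mem.dec (C.mem i)).grp, hport,
    (hR.roles i).1, hpos]
  constructor
  · rintro ⟨j, -, h2, h3, h4, h5, h6⟩
    have hj : C.pos j ≠ I.bh := by rw [h2, ← hpos]; exact hi
    rw [(hR.roles j).1] at h5 h6
    rw [hR.crossing j hj, ← split_iff] at h3
    rw [hR.port j hj] at h4
    rw [hR.pos j] at h2
    refine ⟨agentGrp I j, h5, h6, h3, ?_⟩
    revert h2 h4
    cases (Sg (agentGrp I j)).atFar (agentRole I j)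
    · exact fun h2 h4 => Or.inl ⟨h2, h4⟩
    · exact fun h2 h4 => Or.inr ⟨h2, h4⟩
  · rintro ⟨h, h0, hg, hs, hb⟩
    have key : ∀ k b, (Sg h).atFar k = b → (Sg h).place I.ports b = (Sg (agentGrp I i)).loc →
        (Sg h).gate I.ports b = (Sg (agentGrp I i)).port → ∃ j, j ≠ i ∧
          C.pos j = (Sg (agentGrp I i)).loc ∧ (Mem.dec (C.mem j)).crossing = true ∧
          (Mem.dec (C.mem j)).port = (Sg (agentGrp I i)).port ∧ (Mem.dec (C.mem j)).grp ≠ 0 ∧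
          (Mem.dec (C.mem j)).grp ≠ agentGrp I i := by
      intro k b hk h1 h2
      obtain ⟨j, rfl, rfl⟩ := exists_agent hid h k
      have hj1 : C.pos j = (Sg (agentGrp I i)).loc := by rw [hR.pos, hk, h1]
      have hj : C.pos j ≠ I.bh := by rw [hj1, ← hpos]; exact hi
      refine ⟨j, ?_, hj1, ?_, ?_, ?_, ?_⟩
      · rintro rfl; exact hg rfl
      · rw [hR.crossing j hj, ← split_iff]; exact hs
      · rw [hR.port j hj, hk, h2]
      · rw [(hR.roles j).1]; exact h0
      · rw [(hR.roles j).1]; exact hg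
    rcases hb with ⟨h1, h2⟩ | ⟨h1, h2⟩
    · exact key 2 false atFar_two h1 h2
    · have hne : (Sg h).far I.ports ≠ I.bh := by rw [h1, ← hpos]; exact hi
      rcases hph : (Sg h).phase with _ | _ | _ | _ | _
      · exact absurd hph hs
      · exact key 0 true (by simp [atFar, hph]) h1 h2
      · exact key 1 true (by simp [atFar, hph]) h1 h2
      · exact absurd ((hv h).far_eq (by simp [Live, hph])) hne
      · exact absurd ((hv h).far_eq (by simp [Live, hph])) hne

-- The partners in sight reveal the phase: role `2` sees role `1` during `out`, role `0` during
-- `swapped`, and neither of them once both have been destroyed.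
open Classical in
theorem Represents.moveAct_eq {r : ℕ} (ht : t = 2 * r + 1) {i : Fin 9} (hi : Active I C i) :
    moveAct (view I C i) (Mem.dec (C.mem i)) =
      if (Sg (agentGrp I i)).Moves I.ports I.bh (MayStart I.ports Sg r (agentGrp I i))
        (agentRole I i) then
        Action.move ((Sg (agentGrp I i)).gate I.ports
          ((Sg (agentGrp I i)).atFar (agentRole I i)))
      else if (Sg (agentGrp I i)).phase = Phase.lone then
        Action.terminate (Sg (agentGrp I i)).port
      else Action.stay := by
  have hbh : C.pos i ≠ I.bh := hi.1
  have hrole := hR.roles i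
  have hclock := hR.clock i hbh hi.2
  have hport := hR.port i hbh
  have hcross := hR.crossing i hbh
  have hclaim := hR.claim i
  rw [hi.2] at hclaim
  have hpos := hR.pos i
  have hlt := (hv (agentGrp I i)).inv.1
  have here : ∀ k, k ≠ agentRole I i → ((view I C i).Here (Mem.dec (C.mem i)) k ↔
      (Sg (agentGrp I i)).atFar k = (Sg (agentGrp I i)).atFar (agentRole I i)) := by
    intro k hk
    rw [here_iff hid hR.roles (f := fun g k => (Sg g).place I.ports ((Sg g).atFar k)) hR.pos
      hrole.1 hk, place_eq_iff hlt]
  have hden := fun h => hR.denied_iff hid hv hbh h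
  have hr : (t - 1) / 2 = r := by omega
  unfold moveAct
  rw [hrole.1, hrole.2, hclock, hcross, hport, hr]
  rw [hpos] at hbh
  have hfar := (hv (agentGrp I i)).far_eq
  generalize agentGrp I i = g at *
  generalize agentRole I i = k at *
  rcases hph : (Sg g).phase with _ | _ | _ | _ | _
  · simp only [hden hph, GroupState.crossing, Moves, hph, MayStart]
    simp
  all_goals
    simp only [GroupState.crossing, Moves, hph]
    simp only [atFar, hph] at here hbh ⊢
    simp only [Live, hph] at hfar
    fin_cases k <;> simp_all [place, gate]

omit hid hv hR in
theorem decision_move {i : Fin 9} (h : (Mem.dec (C.mem i)).clock % 2 = 1) :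
    decision searchAlgorithm I C i =
      ⟨({ Mem.dec (C.mem i) with clock := (Mem.dec (C.mem i)).clock + 1 } : Mem).enc, id,
        moveAct (view I C i) (Mem.dec (C.mem i))⟩ := by
  have h0 : (Mem.dec (view I C i).mem).clock ≠ 0 := by
    intro h0
    replace h0 : (Mem.dec (C.mem i)).clock = 0 := h0
    omega
  simp only [decision, searchAlgorithm, searchDecision]
  rw [if_neg h0]
  exact if_pos h

theorem Represents.step_move {r : ℕ} (ht : t = 2 * r + 1) :
    Between I (t + 1) (step searchAlgorithm I t C) Sg r (I.present t) := by
  classical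
  have hclock : ∀ i, Active I C i → (Mem.dec (C.mem i)).clock = t :=
    fun i hi => hR.clock i hi.1 hi.2
  have hdec : ∀ i, Active I C i → decision searchAlgorithm I C i = _ :=
    fun i hi => decision_move (by rw [hclock i hi]; omega)
  have hlt := fun g => (hv g).inv.1
  have hact := fun i hi => hR.moveAct_eq hid hv ht (i := i) hi
  have hperf : ∀ i, Active I C i → perform I.ports (I.present t) (C.pos i)
      (decision searchAlgorithm I C i).act =
      if (Sg (agentGrp I i)).Moves I.ports I.bh (MayStart I.ports Sg r (agentGrp I i))
        (agentRole I i) then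
        traverse I.ports (I.present t)
          ((Sg (agentGrp I i)).place I.ports ((Sg (agentGrp I i)).atFar (agentRole I i)))
          ((Sg (agentGrp I i)).gate I.ports ((Sg (agentGrp I i)).atFar (agentRole I i)))
      else (C.pos i, LastMove.stayed) := by
    intro i hi
    rw [hdec i hi, hact i hi, ← hR.pos i]
    split_ifs <;> rfl
  have hmem : ∀ i, Mem.dec ((step searchAlgorithm I t C).mem i) = if Active I C i then
      { Mem.dec (C.mem i) with clock := (Mem.dec (C.mem i)).clock + 1 } else Mem.dec (C.mem i) := by
    intro i
    simp only [step]
    split_ifs with hi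
    · rw [hdec i hi, Mem.dec_enc]
    · rfl
  -- Inactive agents do not move, and `Moves` has to agree: role `0` destroyed during `out` is
  -- excluded there explicitly, and no one moves in the phases `lone` and `done`.
  have hdead : ∀ i, ¬ Active I C i → ¬ (Sg (agentGrp I i)).Moves I.ports I.bh
      (MayStart I.ports Sg r (agentGrp I i)) (agentRole I i) := by
    intro i hi hm
    have hclaim := hR.claim i
    have hpos := hR.pos i
    have h1 := (hv (agentGrp I i)).far_ne
    have h2 := (hv (agentGrp I i)).inv.2.2.1
    unfold Active Alive at hi
    rw [hclaim, hpos] at hi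
    revert hm hi
    generalize agentGrp I i = g at *
    generalize agentRole I i = k at *
    rcases hph : (Sg g).phase with _ | _ | _ | _ | _
    · simp [Moves, atFar, hph, place, h2]
    all_goals
      simp only [Moves, atFar, hph]
      fin_cases k <;> simp_all [place]
  have hpos : ∀ i, (step searchAlgorithm I t C).pos i = (Sg (agentGrp I i)).place I.ports
      ((Sg (agentGrp I i)).midFar I.ports I.bh (MayStart I.ports Sg r (agentGrp I i))
        (I.present t) (agentRole I i)) := by
    intro i
    simp only [step]
    by_cases hi : Active I C i
    · rw [if_pos hi, hperf i hi, traverse_place (hlt _), hR.pos i]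
      unfold midFar
      split_ifs <;> simp_all
    · have := hdead i hi
      rw [if_neg hi, hR.pos i, midFar, if_neg fun h => this h.1]
  have hbh : ∀ i, (step searchAlgorithm I t C).pos i ≠ I.bh → C.pos i ≠ I.bh := by
    intro i hi h
    simp only [step] at hi
    rw [if_neg fun ha => ha.1 h] at hi
    exact hi h
  have hdec2 : ∀ i, (Mem.dec ((step searchAlgorithm I t C).mem i)).grp = (Mem.dec (C.mem i)).grp ∧
      (Mem.dec ((step searchAlgorithm I t C).mem i)).role = (Mem.dec (C.mem i)).role ∧
      (Mem.dec ((step searchAlgorithm I t C).mem i)).ver = (Mem.dec (C.mem i)).ver ∧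
      (Mem.dec ((step searchAlgorithm I t C).mem i)).port = (Mem.dec (C.mem i)).port ∧
      (Mem.dec ((step searchAlgorithm I t C).mem i)).back = (Mem.dec (C.mem i)).back ∧
      (Mem.dec ((step searchAlgorithm I t C).mem i)).crossing =
        (Mem.dec (C.mem i)).crossing := by
    intro i
    rw [hmem i]
    split_ifs <;> simp
  have hactive : ∀ i, (step searchAlgorithm I t C).pos i ≠ I.bh →
      (step searchAlgorithm I t C).claim i = none → Active I C i := by
    intro i h1 h2
    by_contra hi
    have : (step searchAlgorithm I t C).claim i = C.claim i := by
      simp only [step, if_neg hi]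
    exact hi ⟨hbh i h1, by rw [← this]; exact h2⟩
  refine ⟨fun i => ?_, hpos, fun i hi => ?_, fun i hi => ?_, fun i hi => ?_, fun i hi => ?_,
    fun i hi hc => ?_, fun i hi hc => ?_, fun i => ?_, fun v g => ?_⟩
  · rw [(hdec2 i).1, (hdec2 i).2.1]; exact hR.roles i
  · rw [(hdec2 i).2.2.1]; exact hR.ver i (hbh i hi)
  · rw [(hdec2 i).2.2.2.1]; exact hR.port i (hbh i hi)
  · rw [(hdec2 i).2.2.2.2.1]; exact hR.back i (hbh i hi)
  · rw [(hdec2 i).2.2.2.2.2]; exact hR.crossing i (hbh i hi)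
  · have ha := hactive i hi hc
    rw [hmem i, if_pos ha]
    simp [hclock i ha]
  · have ha := hactive i hi hc
    have hl : (view I (step searchAlgorithm I t C) i).last = (perform I.ports (I.present t)
        (C.pos i) (decision searchAlgorithm I C i).act).2 := by
      simp only [view, step, if_pos ha]
    rw [View.entry, hl, hperf i ha, traverse_place (hlt _), (hdec2 i).2.2.2.1,
      hR.port i (hbh i hi), midFar]
    split_ifs <;> simp_all
  · have h1 := (hv (agentGrp I i)).inv.2.2.1
    by_cases ha : Active I C i
    · have h2 := hR.claim i
      rw [ha.2] at h2
      have h3 : (step searchAlgorithm I t C).claim i =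
          (decision searchAlgorithm I C i).act.declared := by
        simp only [step, if_pos ha]
      rw [h3, hdec i ha, hact i ha]
      have h4 := ha.1
      unfold Alive at h4
      rw [hR.pos i] at h4
      have h5 := (hv (agentGrp I i)).far_eq
      revert h2 h4 h5
      generalize agentGrp I i = g at *
      generalize agentRole I i = k at *
      rcases hph : (Sg g).phase with _ | _ | _ | _ | _
      all_goals
        simp only [Moves, atFar, hph, Live]
        fin_cases k <;> simp [place, Action.declared]
      all_goals
        intro _
        split_ifs <;> rfl
    · have h2 := hR.claim i
      have h3 : (step searchAlgorithm I t C).claim i = C.claim i := by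
        simp only [step, if_neg ha]
      rw [h3, h2]
      unfold Active Alive at ha
      rw [hR.pos i, h2] at ha
      revert ha
      generalize agentGrp I i = g at *
      generalize agentRole I i = k at *
      rcases hph : (Sg g).phase with _ | _ | _ | _ | _
      all_goals
        simp only [atFar, hph, Live]
        fin_cases k <;> simp [place, h1]
  · have := step_board (A := searchAlgorithm) (t := t) (C := C) (I := I) (fun _ => 0)
      (fun _ => none) (by
        intro i hi b
        rw [hdec i hi]
        rfl) g ⟨0, 0, 0⟩ v (by simp)
    rw [this, ← hR.board v g, if_neg (by simp)]

end Refinement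

end BHS

/-! ### Refinement: think rounds -/

namespace BHS

namespace GroupState

variable {V : Type*} {P : PortGraph V} {bh : V} {s : GroupState V}

open Classical in
/-- The decision that the group takes in the think round, if it is gathered and has to decide. -/
noncomputable def verdict (P : PortGraph V) (g : Fin 3) (r : ℕ) (go : Prop) (H : SimpleGraph V)
    (s : GroupState V) : Option Nav :=
  match s.phase with
  | Phase.home =>
    if go ∧ H.Adj s.loc (s.far P) then none
    else if g ≠ 0 ∧ IsTurn g r then
      some (Nav.refuse s.ver s.port s.back (s.slots s.loc) (P.deg s.loc))
    else none
  | Phase.swapped =>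
    if H.Adj s.loc (s.far P) then
      some (Nav.arrive s.ver (s.ent P) s.back (s.slots (s.far P)) (P.deg (s.far P)))
    else none
  | _ => none

variable {g : Fin 3} {r : ℕ} {D : Prop} {H : SimpleGraph V} {n : Nav}

local notation "go" => (g = 0 ∨ IsTurn g r ∧ ¬ D)

/-- A decision is taken only when the whole group is at one end: the near one if it gives up, the
far one if it has landed. The old flag `crossing` tells which. -/
theorem next_of_verdict (h : s.verdict P g r go H = some n) :
    s.next P bh g r D H = s.settle (s.place P s.crossing) n ∧
      ∀ k, s.midFar P bh go H k = s.crossing := by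
  classical
  unfold verdict at h
  unfold GroupState.next midFar
  rcases hph : s.phase with _ | _ | _ | _ | _ <;> rw [hph] at h <;> dsimp only at h ⊢
  · split_ifs at h with h1 h2
    rw [if_neg h1, if_pos h2]
    simp only [Option.some.injEq] at h
    subst h
    refine ⟨by simp [crossing, hph, place, refused], fun k => ?_⟩
    rw [if_neg]
    · simp [atFar, crossing, hph]
    · simp only [Moves, hph]
      exact fun h => h1 ⟨h.1.2, h.2⟩
  · exact absurd h (by simp)
  · split_ifs at h with h1
    rw [if_pos h1]
    simp only [Option.some.injEq] at h
    subst h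
    refine ⟨by simp [crossing, hph, place, landed], fun k => ?_⟩
    by_cases hk : k = 1 <;> simp [Moves, atFar, crossing, hph, h1, hk]
  · exact absurd h (by simp)
  · exact absurd h (by simp)

/-- Without a decision only the phase can change. Being gathered is then the same as being at home,
so a member can update its flag `crossing` from what it sees. -/
theorem next_of_verdict_none (hv : s.Valid P bh) (h : s.verdict P g r go H = none) :
    (∃ φ, s.next P bh g r D H = { s with phase := φ }) ∧
      (∀ k, s.midFar P bh go H k = (s.next P bh g r D H).atFar k) ∧
      (∀ k₀, s.place P (s.midFar P bh go H k₀) ≠ bh →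
        ((∀ k, s.midFar P bh go H k = s.midFar P bh go H k₀) ↔
          (s.next P bh g r D H).crossing = false)) ∧
      ((s.next P bh g r D H).crossing = false → s.crossing = false) := by
  classical
  have h3 := hv.far_eq
  have h4 := hv.far_ne
  unfold verdict at h
  unfold GroupState.next midFar
  rcases hph : s.phase with _ | _ | _ | _ | _ <;> rw [hph] at h <;> dsimp only at h ⊢
  · by_cases h1 : go ∧ H.Adj s.loc (s.far P)
    · simp only [if_pos h1]
      refine ⟨⟨_, rfl⟩, ?_, ?_, ?_⟩ <;>
        simp [Moves, atFar, crossing, hph, h1.1, h1.2, Fin.forall_fin_succ, place]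
    · rw [if_neg h1] at h
      have h2 : ¬ (g ≠ 0 ∧ IsTurn g r) := by
        intro h2
        rw [if_pos h2] at h
        exact absurd h (by simp)
      rw [if_neg h1, if_neg h2]
      have h5 : ∀ k : Fin 3, ¬ ((k = 0 ∧ go) ∧ H.Adj s.loc (s.far P)) := fun k h => h1 ⟨h.1.2, h.2⟩
      simp only [Moves, hph, h5, if_false]
      refine ⟨⟨s.phase, rfl⟩, ?_, ?_, ?_⟩ <;> simp [atFar, crossing, hph]
  · by_cases h1 : H.Adj s.loc (s.far P)
    · simp only [if_pos h1]
      by_cases h2 : s.far P = bh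
      · have h5 : H.Adj s.loc bh := h2 ▸ h1
        refine ⟨⟨_, rfl⟩, ?_, ?_, ?_⟩ <;>
          simp [Moves, atFar, crossing, hph, h5, h2, Fin.forall_fin_succ, place]
      · refine ⟨⟨_, rfl⟩, ?_, ?_, ?_⟩ <;>
          simp [Moves, atFar, crossing, hph, h1, h2, Fin.forall_fin_succ, place]
    · simp only [if_neg h1]
      refine ⟨⟨s.phase, rfl⟩, ?_, ?_, ?_⟩ <;>
        simp [Moves, atFar, crossing, hph, h1, Fin.forall_fin_succ, place]
  · have h1 : ¬ H.Adj s.loc (s.far P) := by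
      intro h1
      rw [if_pos h1] at h
      exact absurd h (by simp)
    simp only [if_neg h1]
    refine ⟨⟨s.phase, rfl⟩, ?_, ?_, ?_⟩ <;>
      simp [Moves, atFar, crossing, hph, h1, Fin.forall_fin_succ, place]
  · have h2 := h3 (by simp [Live, hph])
    refine ⟨⟨_, rfl⟩, ?_, ?_, ?_⟩ <;>
      simp [Moves, atFar, crossing, hph, h2, Fin.forall_fin_succ, place]
  · have h2 := h3 (by simp [Live, hph])
    refine ⟨⟨s.phase, rfl⟩, ?_, ?_, ?_⟩ <;>
      simp [Moves, atFar, crossing, hph, h2, Fin.forall_fin_succ, place]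

theorem atFar_of_crossing (h : s.crossing = false) (k : Fin 3) : s.atFar k = false := by
  unfold crossing at h
  unfold atFar
  split at h
  · rename_i h1; rw [h1]
  · exact absurd h (by simp)

theorem midFar_eq_crossing {k₀ : Fin 3} (hv : s.Valid P bh)
    (hb : s.place P (s.midFar P bh go H k₀) ≠ bh)
    (h : ∀ k, s.midFar P bh go H k = s.midFar P bh go H k₀) :
    s.midFar P bh go H k₀ = s.crossing := by
  rcases hver : s.verdict P g r go H with _ | n
  · obtain ⟨-, h2, h3, h4⟩ := next_of_verdict_none hv hver
    have h5 := (h3 k₀ hb).1 h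
    rw [h4 h5, h2, atFar_of_crossing h5]
  · exact (next_of_verdict hver).2 k₀

/-- The verdict of a group that is gathered and has crossed, or is still at home. -/
theorem verdict_eq {k₀ : Fin 3} (hv : s.Valid P bh) (hb : s.place P (s.midFar P bh go H k₀) ≠ bh) :
    s.verdict P g r go H = if ∀ k, s.midFar P bh go H k = s.midFar P bh go H k₀ then
      if s.crossing then
        some (Nav.arrive s.ver (s.ent P) s.back (s.slots (s.far P)) (P.deg (s.far P)))
      else if g ≠ 0 ∧ IsTurn g r then
        some (Nav.refuse s.ver s.port s.back (s.slots s.loc) (P.deg s.loc))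
      else none
    else none := by
  classical
  rcases hver : s.verdict P g r go H with _ | n
  · obtain ⟨-, -, h3, h4⟩ := next_of_verdict_none hv hver
    split_ifs with h5 h6 h7
    · exact absurd h6 (by rw [h4 ((h3 k₀ hb).1 h5)]; simp)
    · exfalso
      rcases hph : s.phase with _ | _ | _ | _ | _ <;>
        simp only [crossing, hph, not_true_eq_false] at h6
      unfold verdict at hver
      rw [hph] at hver
      dsimp only at hver
      by_cases h1 : go ∧ H.Adj s.loc (s.far P)
      · have := (h5 0).trans (h5 1).symm
        simp [midFar, Moves, atFar, hph, h1.1, h1.2] at this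
      · rw [if_neg h1, if_pos h7] at hver
        exact absurd hver (by simp)
    · rfl
    · rfl
  · have h1 := (next_of_verdict (bh := bh) hver).2
    rw [if_pos fun k => (h1 k).trans (h1 k₀).symm]
    unfold verdict at hver
    rcases hph : s.phase with _ | _ | _ | _ | _ <;> rw [hph] at hver <;> dsimp only at hver
    · split_ifs at hver with h2 h3
      rw [if_neg (by simp [crossing, hph]), if_pos h3, hver]
    · exact absurd hver (by simp)
    · split_ifs at hver with h2
      rw [if_pos (by simp [crossing, hph]), hver]
    · exact absurd hver (by simp)
    · exact absurd hver (by simp)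

end GroupState

open GroupState

section Refinement

variable {V : Type*} {I : Instance V 9} {t : ℕ} {C : Config V 9} {Sg : Fin 3 → GroupState V}
  {r : ℕ} {H : SimpleGraph V} (hid : Function.Injective I.id)
  (hv : ∀ g, (Sg g).Valid I.ports I.bh) (hB : Between I t C Sg r H) (ht : t = 2 * r + 2)

/-- The states of the groups after macro round `r`. -/
noncomputable def nextStates (I : Instance V 9) (Sg : Fin 3 → GroupState V) (r : ℕ)
    (H : SimpleGraph V) (g : Fin 3) : GroupState V :=
  (Sg g).next I.ports I.bh g r (Denied I.ports Sg g) H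

include hid hv hB

theorem Between.gathered_iff {i : Fin 9} :
    (view I C i).Gathered (Mem.dec (C.mem i)) ↔ ∀ k,
      (Sg (agentGrp I i)).midFar I.ports I.bh (MayStart I.ports Sg r (agentGrp I i)) H k =
      (Sg (agentGrp I i)).midFar I.ports I.bh (MayStart I.ports Sg r (agentGrp I i)) H
        (agentRole I i) := by
  rw [BHS.gathered_iff hid hB.roles (f := fun g k => (Sg g).place I.ports ((Sg g).midFar I.ports
    I.bh (MayStart I.ports Sg r g) H k)) hB.pos (hB.roles i).1 (hB.roles i).2]
  simp only [place_eq_iff (hv _).inv.1]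

include ht

theorem Between.thinkNav_eq {i : Fin 9} (hi : Active I C i) :
    thinkNav (view I C i) (Mem.dec (C.mem i)) =
      (Sg (agentGrp I i)).verdict I.ports (agentGrp I i) r
        (MayStart I.ports Sg r (agentGrp I i)) H := by
  classical
  have hbh : C.pos i ≠ I.bh := hi.1
  have hb := hbh
  rw [hB.pos i] at hb
  have hg := hB.gathered_iff hid hv (i := i)
  have h1 := verdict_eq (hv (agentGrp I i)) hb
  have h2 := midFar_eq_crossing (hv (agentGrp I i)) hb
  unfold thinkNav
  have hr : ((Mem.dec (C.mem i)).clock - 1) / 2 = r := by rw [hB.clock i hbh hi.2]; omega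
  rw [hr, hB.entry i hbh hi.2, hB.crossing i hbh, hB.ver i hbh, hB.port i hbh, hB.back i hbh,
    (hB.roles i).1]
  have hbd : Board.dec (view I C i).board (agentGrp I i) = (Sg (agentGrp I i)).slots (C.pos i) :=
    hB.board _ _
  have hdg : (view I C i).deg = I.ports.deg (C.pos i) := rfl
  rw [hbd, hdg, hB.pos i]
  by_cases hgath : (view I C i).Gathered (Mem.dec (C.mem i))
  · have hall := hg.1 hgath
    have h3 := h2 hall
    unfold MayStart at hall h3 ⊢
    rw [h1, if_pos hgath, if_pos hall, h3]
    by_cases hc : (Sg (agentGrp I i)).crossing = true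
    · rw [if_pos hc, if_pos hc]
      simp [hc, place, gate]
    · rw [if_neg hc, if_neg hc]
      rw [Bool.not_eq_true] at hc
      simp [hc, place, gate, atFar_of_crossing hc]
  · unfold MayStart at hg ⊢
    rw [h1, if_neg hgath, if_neg fun h => hgath (hg.2 h)]

end Refinement

end BHS

namespace BHS

open GroupState

namespace GroupState

/-- The claim is made in the move round that starts from `lone`, half a macro round before the phase
reads `done`; this reconciles the claims of `Between` with those of `Represents`. -/
theorem next_done_iff {V : Type*} {P : PortGraph V} {bh : V} {s : GroupState V} {g : Fin 3} {r : ℕ}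
    {D : Prop} {H : SimpleGraph V} : (s.next P bh g r D H).phase = Phase.done ↔ ¬ s.Live := by
  classical
  unfold GroupState.next Live
  rcases hph : s.phase with _ | _ | _ | _ | _ <;> dsimp only
  · split_ifs <;> simp [refused, settle, hph]
  · split_ifs <;> simp [hph]
  · split_ifs <;> simp [landed, settle, hph]
  · simp
  · simp [hph]

theorem next_of_not_live {V : Type*} {P : PortGraph V} {bh : V} {s : GroupState V} {g : Fin 3}
    {r : ℕ} {D : Prop} {H : SimpleGraph V} (h : ¬ s.Live) :
    s.next P bh g r D H = { s with phase := Phase.done } ∧ s.crossing = true := by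
  unfold GroupState.next crossing
  unfold Live at h
  rcases hph : s.phase with _ | _ | _ | _ | _ <;> simp [hph] at h ⊢
  rw [← hph]

/-- Ensures that a deciding group has an active member at the place of decision, so that the new
slot is really written. -/
theorem live_of_verdict {V : Type*} {P : PortGraph V} {bh : V} {s : GroupState V} {g : Fin 3}
    {r : ℕ} {go : Prop} {H : SimpleGraph V} {n : Nav} (hv : s.Valid P bh)
    (h : s.verdict P g r go H = some n) : s.Live ∧ s.place P s.crossing ≠ bh := by
  have h1 := hv.far_ne
  have h2 := hv.inv.2.2.1
  unfold verdict at h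
  unfold Live place crossing
  rcases hph : s.phase with _ | _ | _ | _ | _ <;> rw [hph] at h <;> simp_all

end GroupState

section Refinement

variable {V : Type*} {I : Instance V 9} {t : ℕ} {C : Config V 9} {Sg : Fin 3 → GroupState V}
  {r : ℕ} {H : SimpleGraph V} (hid : Function.Injective I.id)
  (hv : ∀ g, (Sg g).Valid I.ports I.bh) (hB : Between I t C Sg r H) (ht : t = 2 * r + 2)

theorem decision_think {i : Fin 9} (h0 : (Mem.dec (C.mem i)).clock ≠ 0)
    (h : (Mem.dec (C.mem i)).clock % 2 = 0) :
    decision searchAlgorithm I C i =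
      ⟨(thinkMem (view I C i) (Mem.dec (C.mem i))).enc,
        thinkEdit (view I C i) (Mem.dec (C.mem i)), Action.stay⟩ := by
  have h1 : ¬ (Mem.dec (view I C i).mem).clock % 2 = 1 := by
    intro h1
    replace h1 : (Mem.dec (C.mem i)).clock % 2 = 1 := h1
    omega
  simp only [decision, searchAlgorithm, searchDecision]
  rw [if_neg (by exact h0), if_neg h1]
  rfl

theorem thinkMem_grp_role (v : View) (m : Mem) :
    (thinkMem v m).grp = m.grp ∧ (thinkMem v m).role = m.role ∧
      (thinkMem v m).clock = m.clock + 1 := by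
  unfold thinkMem
  split
  · simp
  · split_ifs <;> simp

include hv hB

theorem nextStates_place (i : Fin 9) : C.pos i = (nextStates I Sg r H (agentGrp I i)).place I.ports
    ((nextStates I Sg r H (agentGrp I i)).atFar (agentRole I i)) := by
  rw [hB.pos i]
  unfold MayStart nextStates
  rcases hver : (Sg (agentGrp I i)).verdict I.ports (agentGrp I i) r
    (MayStart I.ports Sg r (agentGrp I i)) H with _ | n <;> unfold MayStart at hver
  · obtain ⟨⟨φ, h1⟩, h2, -⟩ := next_of_verdict_none (hv (agentGrp I i)) hver
    rw [h2, h1]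
    rfl
  · obtain ⟨h1, h2⟩ := next_of_verdict (bh := I.bh) hver
    rw [h2, h1, atFar_of_crossing (s := settle _ _ _) rfl]
    rfl

include hid ht

theorem Between.think_mem_active {i : Fin 9} (ha : Active I C i) :
    (thinkMem (view I C i) (Mem.dec (C.mem i))).ver =
      (nextStates I Sg r H (agentGrp I i)).ver ∧
    (thinkMem (view I C i) (Mem.dec (C.mem i))).port =
      (nextStates I Sg r H (agentGrp I i)).gate I.ports
        ((nextStates I Sg r H (agentGrp I i)).atFar (agentRole I i)) ∧
    (thinkMem (view I C i) (Mem.dec (C.mem i))).back =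
      (nextStates I Sg r H (agentGrp I i)).back ∧
    (thinkMem (view I C i) (Mem.dec (C.mem i))).crossing =
      (nextStates I Sg r H (agentGrp I i)).crossing := by
  have hi : C.pos i ≠ I.bh := ha.1
  have hver := hB.ver i hi
  have hport := hB.port i hi
  have hback := hB.back i hi
  have hcross := hB.crossing i hi
  unfold thinkMem
  rw [hB.thinkNav_eq hid hv ht ha]
  have hentry := hB.entry i hi ha.2
  have hb := hi
  rw [hB.pos i] at hb
  have hg := hB.gathered_iff hid hv (i := i)
  unfold nextStates
  generalize Mem.dec (C.mem i) = m at *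
  generalize view I C i = v at *
  rcases hverd : (Sg (agentGrp I i)).verdict I.ports (agentGrp I i) r
    (MayStart I.ports Sg r (agentGrp I i)) H with _ | n <;>
    unfold MayStart at hverd hentry hb hg
  · obtain ⟨⟨φ, h1⟩, h2, h3, h4⟩ := next_of_verdict_none (hv (agentGrp I i)) hverd
    rw [h3 _ hb] at hg
    rw [h2] at hentry
    generalize next _ _ _ _ _ _ (Sg (agentGrp I i)) = s' at *
    have e1 : s'.ver = (Sg (agentGrp I i)).ver := by rw [h1]
    have e2 : s'.back = (Sg (agentGrp I i)).back := by rw [h1]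
    have e3 : ∀ b, s'.gate I.ports b = (Sg (agentGrp I i)).gate I.ports b := by
      rw [h1]; exact fun b => rfl
    rw [e1, e2, e3]
    by_cases hgath : v.Gathered m
    · have h5 := hg.1 hgath
      rw [atFar_of_crossing (h4 h5)] at hport
      rw [h4 h5] at hcross
      simp only [if_pos hgath, atFar_of_crossing h5, h5]
      exact ⟨hver, hport, hback, hcross⟩
    · have h5 : s'.crossing = true := by
        rw [← Bool.not_eq_false]
        exact fun h5 => hgath (hg.2 h5)
      simp only [if_neg hgath, h5]
      exact ⟨hver, hentry, hback, trivial⟩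
  · obtain ⟨h1, h2⟩ := next_of_verdict (bh := I.bh) hverd
    rw [h1, atFar_of_crossing (s := settle _ _ _) rfl]
    exact ⟨rfl, rfl, rfl, rfl⟩

omit hid hv ht in
theorem Between.idle_mem {i : Fin 9} (hi : C.pos i ≠ I.bh) (ha : ¬ Active I C i) :
    (Mem.dec (C.mem i)).ver = (nextStates I Sg r H (agentGrp I i)).ver ∧
    (Mem.dec (C.mem i)).port = (nextStates I Sg r H (agentGrp I i)).gate I.ports
        ((nextStates I Sg r H (agentGrp I i)).atFar (agentRole I i)) ∧
    (Mem.dec (C.mem i)).back = (nextStates I Sg r H (agentGrp I i)).back ∧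
    (Mem.dec (C.mem i)).crossing = (nextStates I Sg r H (agentGrp I i)).crossing := by
  have hport := hB.port i hi
  have h1 := hB.claim i
  have h2 : C.claim i ≠ none := fun h => ha ⟨hi, h⟩
  rw [h1] at h2
  have h3 : ¬ (Sg (agentGrp I i)).Live ∧ agentRole I i = 2 := by
    by_contra h3
    rw [if_neg h3] at h2
    exact h2 rfl
  obtain ⟨h4, h5⟩ := next_of_not_live (P := I.ports) (bh := I.bh) (g := agentGrp I i) (r := r)
    (D := Denied I.ports Sg (agentGrp I i)) (H := H) h3.1
  unfold nextStates
  rw [h4, h3.2, atFar_two]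
  rw [h3.2, atFar_two] at hport
  exact ⟨hB.ver i hi, hport, hB.back i hi, (hB.crossing i hi).trans h5⟩

theorem Between.step_think :
    Represents I (t + 1) (step searchAlgorithm I t C) (nextStates I Sg r H) := by
  classical
  have hclock : ∀ i, Active I C i → (Mem.dec (C.mem i)).clock = t :=
    fun i hi => hB.clock i hi.1 hi.2
  have hdec : ∀ i, Active I C i → decision searchAlgorithm I C i = _ :=
    fun i hi => decision_think (by rw [hclock i hi]; omega) (by rw [hclock i hi]; omega)
  have hpos : ∀ i, (step searchAlgorithm I t C).pos i = C.pos i := by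
    intro i
    simp only [step]
    split_ifs with hi
    · rw [hdec i hi]; rfl
    · rfl
  have hclaim : ∀ i, (step searchAlgorithm I t C).claim i = C.claim i := by
    intro i
    simp only [step]
    split_ifs with hi
    · rw [hdec i hi, hi.2]; rfl
    · rfl
  have hmem : ∀ i, Mem.dec ((step searchAlgorithm I t C).mem i) = if Active I C i then
      thinkMem (view I C i) (Mem.dec (C.mem i)) else Mem.dec (C.mem i) := by
    intro i
    simp only [step]
    split_ifs with hi
    · rw [hdec i hi, Mem.dec_enc]
    · rfl
  have hnav := fun i hi => hB.thinkNav_eq hid hv ht (i := i) hi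
  have main : ∀ i, C.pos i ≠ I.bh → ∀ m, m = Mem.dec ((step searchAlgorithm I t C).mem i) →
      m.ver = (nextStates I Sg r H (agentGrp I i)).ver ∧
      m.port = (nextStates I Sg r H (agentGrp I i)).gate I.ports
        ((nextStates I Sg r H (agentGrp I i)).atFar (agentRole I i)) ∧
      m.back = (nextStates I Sg r H (agentGrp I i)).back ∧
      m.crossing = (nextStates I Sg r H (agentGrp I i)).crossing := by
    rintro i hi _ rfl
    rw [hmem i]
    split_ifs with ha
    · exact hB.think_mem_active hid hv ht ha
    · exact hB.idle_mem hi ha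
  refine ⟨fun i => ?_, fun i => ?_, fun i hi => ?_, fun i hi => ?_, fun i hi => ?_, fun i hi => ?_,
    fun i hi hc => ?_, fun i => ?_, fun v g => ?_⟩
  · rw [hmem i]
    have := thinkMem_grp_role (view I C i) (Mem.dec (C.mem i))
    split_ifs
    · rw [this.1, this.2.1]; exact hB.roles i
    · exact hB.roles i
  · rw [hpos i]; exact nextStates_place hv hB i
  · exact (main i (hpos i ▸ hi) _ rfl).1
  · exact (main i (hpos i ▸ hi) _ rfl).2.1
  · exact (main i (hpos i ▸ hi) _ rfl).2.2.1
  · exact (main i (hpos i ▸ hi) _ rfl).2.2.2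
  · have ha : Active I C i := ⟨show C.pos i ≠ I.bh from hpos i ▸ hi, hclaim i ▸ hc⟩
    rw [hmem i, if_pos ha, (thinkMem_grp_role _ _).2.2, hclock i ha]
  · rw [hclaim i, hB.claim i]
    unfold nextStates
    rw [next_done_iff]
    split_ifs with h
    · rw [(next_of_not_live h.1).1]
    · rfl
  · have hedit : ∀ i, Active I C i → ∀ b, (decision searchAlgorithm I C i).edit b =
        match (if Active I C i then
          (thinkNav (view I C i) (Mem.dec (C.mem i))).map Nav.slot else none) with
        | some x => writeSlot (agentGrp I i) x b
        | none => b := by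
      intro i hi b
      rw [hdec i hi, if_pos hi]
      dsimp only [thinkEdit]
      rw [(hB.roles i).1]
      cases thinkNav (view I C i) (Mem.dec (C.mem i)) <;> rfl
    have hB' := hB.board
    have hsb := fun x hx => step_board (t := t) (agentGrp I) _ hedit g x v hx
    -- All active members of a group reach the same verdict, so `step_board` applies with its slot,
    -- or with a dummy value if nobody writes.
    rcases hverd : (Sg g).verdict I.ports g r (MayStart I.ports Sg r g) H with _ | n
    · have hno : ∀ i, Active I C i → agentGrp I i = g →
          thinkNav (view I C i) (Mem.dec (C.mem i)) = none := by
        rintro i hi rfl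
        rw [hnav i hi, hverd]
      rw [hsb ⟨0, 0, 0⟩ (fun i hi _ hg => by rw [if_pos hi, hno i hi hg]; exact Or.inl rfl),
        if_neg, hB' v g]
      · obtain ⟨⟨φ, h1⟩, -⟩ := next_of_verdict_none (hv g) hverd
        unfold nextStates
        rw [h1]
      · rintro ⟨i, h1, -, h2, h3⟩
        rw [if_pos h1, hno i h1 h2] at h3
        exact absurd h3 (by simp)
    · have hyes : ∀ i, Active I C i → agentGrp I i = g →
          thinkNav (view I C i) (Mem.dec (C.mem i)) = some n := by
        rintro i hi rfl
        rw [hnav i hi, hverd]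
      unfold MayStart at hverd
      obtain ⟨h1, h2⟩ := next_of_verdict (bh := I.bh) hverd
      have hplace : ∀ i, agentGrp I i = g → C.pos i = (Sg g).place I.ports (Sg g).crossing := by
        rintro i rfl
        rw [hB.pos i]
        unfold MayStart
        rw [h2]
      rw [hsb n.slot (fun i hi _ hg => by rw [if_pos hi, hyes i hi hg]; exact Or.inr rfl), hB' v g]
      unfold nextStates
      rw [h1]
      by_cases hvp : v = (Sg g).place I.ports (Sg g).crossing
      · rw [if_pos]
        · simp [settle, hvp]
        · obtain ⟨i, rfl, hi2⟩ := exists_agent hid g 2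
          have hne : C.pos i ≠ I.bh := by
            rw [hplace i rfl]
            exact (live_of_verdict (hv _) hverd).2
          have hcl : C.claim i = none := by
            rw [hB.claim i, if_neg]
            exact fun h => h.1 (live_of_verdict (hv _) hverd).1
          exact ⟨i, ⟨hne, hcl⟩, (hplace i rfl).trans hvp.symm, rfl, by
            rw [if_pos ⟨hne, hcl⟩, hyes i ⟨hne, hcl⟩ rfl]; rfl⟩
      · rw [if_neg]
        · simp [settle, hvp]
        · rintro ⟨i, -, h3, h4, -⟩
          exact hvp (h3.symm.trans (hplace i h4))

end Refinement

end BHS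

/-! ### Correctness of the algorithm -/

namespace BHS

open GroupState

section Correctness

variable {V : Type*} {I : Instance V 9}

theorem represents_first (hid : Function.Injective I.id) (hroot : I.root ≠ I.bh) :
    Represents I 1 (run searchAlgorithm I 1) (fun _ => start I.root) := by
  classical
  have hclock : (Mem.dec []).clock = 0 := by
    have h : Nat.unpair 0 = (0, 0) := by decide
    simp [Mem.dec, Mem.ofCode, natOfBits, h]
  have ha : ∀ i, Active I (run searchAlgorithm I 0) i := fun i => ⟨hroot, rfl⟩
  have hdec : ∀ i, decision searchAlgorithm I (run searchAlgorithm I 0) i =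
      ⟨(firstMem (view I (run searchAlgorithm I 0) i)).enc,
        writeSlot (firstMem (view I (run searchAlgorithm I 0) i)).grp (Nav.restart 0).slot,
        Action.stay⟩ := by
    intro i
    simp only [decision, searchAlgorithm, searchDecision]
    exact if_pos hclock
  have hfirst : ∀ i, firstMem (view I (run searchAlgorithm I 0) i) =
      ⟨agentGrp I i, agentRole I i, 1, 1, 0, false, false⟩ := by
    intro i
    rw [firstMem, view_rank hid fun j => rfl]
    rfl
  have hmem : ∀ i, Mem.dec ((run searchAlgorithm I 1).mem i) =
      ⟨agentGrp I i, agentRole I i, 1, 1, 0, false, false⟩ := by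
    intro i
    rw [run, ← hfirst i, ← Mem.dec_enc (firstMem _)]
    simp only [step, if_pos (ha i), hdec i]
  refine ⟨fun i => by simp [hmem], fun i => ?_, fun i _ => by rw [hmem]; rfl,
    fun i _ => by rw [hmem]; rfl, fun i _ => by rw [hmem]; rfl, fun i _ => by rw [hmem]; rfl,
    fun i _ _ => by rw [hmem], fun i => ?_, fun v g => ?_⟩
  · rw [run]
    simp only [step, if_pos (ha i), hdec i]
    rfl
  · rw [run]
    simp only [step, if_pos (ha i), hdec i]
    rw [if_neg fun h => absurd h.1 (by simp [start, settle])]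
    rfl
  · rw [run, step_board (agentGrp I) (fun _ => some (Nav.restart 0).slot) (fun i _ b => by
      rw [hdec i]; dsimp only; rw [hfirst i]) g (Nav.restart 0).slot v
      (fun _ _ _ _ => Or.inr rfl)]
    by_cases hv : v = I.root
    · obtain ⟨i, hi, -⟩ := exists_agent hid g 0
      rw [if_pos ⟨i, ha i, hv.symm, hi, rfl⟩, hv]
      simp [start, settle]
    · rw [if_neg fun ⟨i, _, h, _⟩ => hv h.symm]
      simp only [start, settle, Function.update_of_ne hv]
      exact Board.dec_nil g

theorem represents_run [Fintype V] (hid : Function.Injective I.id) (hroot : I.root ≠ I.bh)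
    (hdeg : ∀ x, 0 < I.ports.deg x) (r : ℕ) :
    Represents I (2 * r + 1) (run searchAlgorithm I (2 * r + 1))
      (groupRun I.ports I.bh I.root (fun r => I.present (2 * r + 1)) r) := by
  induction r with
  | zero => exact represents_first hid hroot
  | succ r ih =>
    have hv := fun g => groupRun_valid (K := fun r => I.present (2 * r + 1)) hdeg hroot r g
    exact (ih.step_move hid hv rfl).step_think hid hv rfl

theorem Represents.hasFound {t : ℕ} {C : Config V 9} {Sg : Fin 3 → GroupState V}
    (hR : Represents I t C Sg) (hv : ∀ g, (Sg g).Valid I.ports I.bh) {i : Fin 9}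
    (hi : (Sg (agentGrp I i)).phase = Phase.done ∧ agentRole I i = 2) : HasFound I C i := by
  have hpos := hR.pos i
  rw [hi.2, atFar_two] at hpos
  replace hpos : C.pos i = (Sg (agentGrp I i)).loc := hpos
  have h := (hv (agentGrp I i)).inv
  refine ⟨?_, (Sg (agentGrp I i)).port, ?_, ?_⟩
  · rw [Alive, hpos]; exact h.2.2.1
  · rw [hR.claim i, if_pos hi]
  · have := PortGraph.leadsTo_far h.1
    rw [hpos]
    have h2 : (Sg (agentGrp I i)).far I.ports = I.bh :=
      (hv (agentGrp I i)).far_eq fun hl => hl.2 hi.1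
    rw [← h2]
    exact this

/-- A terminated agent does not change any more. -/
theorem run_of_claim {A : Algorithm} {i : Fin 9} {t t' : ℕ} (h : t ≤ t')
    (hc : (run A I t).claim i ≠ none) :
    (run A I t').claim i = (run A I t).claim i ∧ (run A I t').pos i = (run A I t).pos i := by
  induction t', h using Nat.le_induction with
  | base => exact ⟨rfl, rfl⟩
  | succ t' h ih =>
    have : ¬ Active I (run A I t') i := fun h => hc (ih.1 ▸ h.2)
    rw [run]
    simp only [step, if_neg this]
    exact ih

theorem hasFound_congr {C C' : Config V 9} {i : Fin 9} (h1 : C'.claim i = C.claim i)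
    (h2 : C'.pos i = C.pos i) : HasFound I C' i ↔ HasFound I C i := by
  unfold HasFound Alive
  rw [h1, h2]

theorem solvesWithin [Fintype V] {c : ℕ} (hI : I.Valid 1 c) {T : ℕ}
    (hT : 33000 * I.ports.numEdges ^ 2 ≤ T) : SolvesWithin searchAlgorithm I T := by
  have hroot := hI.root_safe
  have hid := hI.id_injective
  have hadm := hI.admissible
  have hc : I.ports.graph.Connected := (hadm 0).2.1.mono (hadm 0).1
  have hn : 1 < Fintype.card V := Fintype.one_lt_card_iff.2 ⟨_, _, hroot⟩
  have hdeg := fun x => PortGraph.deg_pos hc hn x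
  have hE : 1 ≤ I.ports.numEdges := by
    have := PortGraph.card_le hc
    omega
  have hv := fun r g => groupRun_valid (K := fun r => I.present (2 * r + 1)) hdeg hroot r g
  have hrep := represents_run hid hroot hdeg
  constructor
  · intro t i h
    -- The refinement is available at odd times only; a claim made by time `t` persists until `2 * t
    -- + 1`.
    obtain ⟨h1, h2⟩ := run_of_claim (A := searchAlgorithm) (I := I) (t := t) (t' := 2 * t + 1)
      (by omega) h
    rw [← hasFound_congr h1 h2]
    refine (hrep t).hasFound (hv t) ?_
    have h3 := (hrep t).claim i
    by_contra h4
    rw [if_neg h4] at h3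
    exact h (h1.symm.trans h3)
  · obtain ⟨r, hr, g, hg⟩ := exists_done (K := fun r => I.present (2 * r + 1)) (bh := I.bh)
      (root := I.root) (fun r => hadm (2 * r + 1)) hc hE hdeg hroot
    obtain ⟨i, rfl, hi⟩ := exists_agent hid g 2
    have hf := (hrep r).hasFound (hv r) ⟨hg, hi⟩
    -- From `r ≤ 30|E| (2 + 540|E|) + 1` follows `2 * r + 1 ≤ 32400|E|² + 120|E| + 3`, which is at
    -- most `33000|E|²` as `|E| ≥ 1`.
    have hle : 2 * r + 1 ≤ T := by nlinarith
    have hcl : (run searchAlgorithm I (2 * r + 1)).claim i ≠ none := by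
      obtain ⟨-, p, hp, -⟩ := hf
      rw [hp]; simp
    obtain ⟨h1, h2⟩ := run_of_claim hle hcl
    exact ⟨i, (hasFound_congr h1 h2).2 hf⟩

end Correctness

end BHS

/-! ### Bounds on memory and whiteboards -/

namespace BHS

section Bits

/-- `Nat.pair` at most squares a bound, so the exponent doubles with each level of nesting: six
levels give the `64` of `Mem.code_le`, four the `16` of `Board.code_le`. -/
theorem pair_succ_le {a b Y k : ℕ} (ha : a + 1 ≤ Y ^ k) (hb : b + 1 ≤ Y ^ k) :
    Nat.pair a b + 1 ≤ Y ^ (k * 2) := by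
  have h := Nat.pair_lt_max_add_one_sq a b
  have h2 : max a b + 1 ≤ Y ^ k := by omega
  have h3 := Nat.pow_le_pow_left h2 2
  rw [← pow_mul] at h3
  omega

/-- All numbers in a memory are at most `X`. -/
def Mem.Le (m : Mem) (X : ℕ) : Prop := m.clock ≤ X ∧ m.ver ≤ X ∧ m.port ≤ X

/-- All numbers in a slot are at most `X`. -/
def Slot.Le (s : Slot) (X : ℕ) : Prop := s.ver ≤ X ∧ s.par ≤ X ∧ s.ptr ≤ X

/-- The slack in `X + 2` makes room for groups, roles and flags, which are at most `2` even when `X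
= 0`. -/
theorem le_pow_of_le {a X k : ℕ} (h : a ≤ X + 2) (hk : k ≠ 0) : a + 1 ≤ (X + 3) ^ k :=
  (show a + 1 ≤ X + 3 by omega).trans (Nat.le_self_pow hk _)

theorem Mem.code_le {m : Mem} {X : ℕ} (h : m.Le X) : m.code + 1 ≤ (X + 3) ^ 64 := by
  obtain ⟨h1, h2, h3⟩ := h
  have hb := Bool.toNat_le m.back
  have hc := Bool.toNat_le m.crossing
  have hg := m.grp.2
  have hr := m.role.2
  unfold Mem.code
  generalize m.back.toNat = x1 at *
  generalize m.crossing.toNat = x2 at *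
  have e1 := pair_succ_le (k := 1) (le_pow_of_le (a := x1) (X := X) (by omega) one_ne_zero)
    (le_pow_of_le (a := x2) (by omega) one_ne_zero)
  have e2 := pair_succ_le (le_pow_of_le (a := m.port) (by omega) (by norm_num)) e1
  have e3 := pair_succ_le (le_pow_of_le (a := m.ver) (by omega) (by norm_num)) e2
  have e4 := pair_succ_le (le_pow_of_le (a := m.clock) (by omega) (by norm_num)) e3
  have e5 := pair_succ_le (le_pow_of_le (a := m.role) (by omega) (by norm_num)) e4
  have e6 := pair_succ_le (le_pow_of_le (a := m.grp) (by omega) (by norm_num)) e5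
  norm_num only at e6
  exact e6

theorem Slot.code_le {s : Slot} {X : ℕ} (h : s.Le X) : s.code + 1 ≤ (X + 3) ^ 4 := by
  obtain ⟨h1, h2, h3⟩ := h
  have e1 := pair_succ_le (k := 1) (le_pow_of_le (a := s.par) (X := X) (by omega) one_ne_zero)
    (le_pow_of_le (a := s.ptr) (by omega) one_ne_zero)
  have e2 := pair_succ_le (le_pow_of_le (a := s.ver) (by omega) (by norm_num)) e1
  norm_num only at e2
  exact e2

theorem Board.code_le {b : Board} {X : ℕ} (h : ∀ g, (b g).Le X) :
    Board.code b + 1 ≤ (X + 3) ^ 16 := by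
  have h4 : (X + 3) ^ 4 ≤ (X + 3) ^ (4 * 2) := Nat.pow_le_pow_right (by omega) (by omega)
  have e1 := pair_succ_le ((Slot.code_le (h 0)).trans h4)
    (pair_succ_le (Slot.code_le (h 1)) (Slot.code_le (h 2)))
  norm_num only at e1
  exact e1

theorem bits_length_le {x k : ℕ} (h : x + 1 ≤ 2 ^ k) : x.bits.length ≤ k := by
  rw [Nat.size_eq_bits_len]
  exact Nat.size_le.2 (by omega)

/-- All numbers in a decision of a group are at most `X`. -/
def Nav.Le (n : Nav) (X : ℕ) : Prop := n.ver ≤ X ∧ n.port ≤ X ∧ n.slot.Le X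

theorem Nav.restart_le {ver X : ℕ} (h : ver ≤ X) : (Nav.restart ver).Le (X + 1) := by
  simp only [Nav.Le, Nav.restart, Slot.Le]
  omega

theorem Nav.advance_le {ver par ptr deg X : ℕ} (h : ver ≤ X) (h1 : par ≤ X + 1)
    (h2 : ptr ≤ X + 1) : (Nav.advance ver par ptr deg).Le (X + 1) := by
  unfold Nav.advance
  split_ifs
  · simp only [Nav.Le, Slot.Le]; omega
  · exact Nav.restart_le h
  · simp only [Nav.Le, Slot.Le]; omega

theorem Nav.arrive_le {ver q deg X : ℕ} {back : Bool} {s : Slot} (h : ver ≤ X) (h1 : q ≤ X)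
    (h2 : s.Le X) : (Nav.arrive ver q back s deg).Le (X + 1) := by
  unfold Nav.arrive
  obtain ⟨h3, h4, h5⟩ := h2
  split_ifs
  · exact Nav.advance_le h (by omega) (by omega)
  · simp only [Nav.Le, Slot.Le]; omega
  · exact Nav.advance_le h (by omega) (by omega)

theorem Nav.refuse_le {ver p deg X : ℕ} {back : Bool} {s : Slot} (h : ver ≤ X) (h1 : p ≤ X)
    (h2 : s.Le X) : (Nav.refuse ver p back s deg).Le (X + 1) := by
  unfold Nav.refuse
  obtain ⟨h3, h4, h5⟩ := h2
  split_ifs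
  · exact Nav.restart_le h
  · exact Nav.advance_le h (by omega) (by omega)

/-- All numbers that are stored, or perceived by an agent, are at most `X`. -/
structure Bounded {V : Type*} (C : Config V 9) (X : ℕ) : Prop where
  mem : ∀ i, ∃ m : Mem, C.mem i = m.enc ∧ m.Le X
  board : ∀ v, ∃ b : Board, C.board v = Board.enc b ∧ ∀ g, (b g).Le X
  last : ∀ i q, C.last i = LastMove.arrived q → q ≤ X

variable {V : Type*} {I : Instance V 9}

theorem thinkNav_le {v : View} {m : Mem} {X : ℕ} (hm : m.Le X)
    (hb : (Board.dec v.board m.grp).Le X) (hl : ∀ q, v.last = LastMove.arrived q → q ≤ X)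
    {n : Nav} (hn : thinkNav v m = some n) : n.Le (X + 1) := by
  have he : v.entry m ≤ X := by
    unfold View.entry
    split
    · rename_i h; exact hl _ h
    · exact hm.2.2
  unfold thinkNav at hn
  split_ifs at hn
  · simp only [Option.some.injEq] at hn
    subst hn
    exact Nav.arrive_le hm.2.1 he hb
  · simp only [Option.some.injEq] at hn
    subst hn
    exact Nav.refuse_le hm.2.1 hm.2.2 hb

theorem thinkMem_le {v : View} {m : Mem} {X : ℕ} (hm : m.Le X)
    (hb : (Board.dec v.board m.grp).Le X) (hl : ∀ q, v.last = LastMove.arrived q → q ≤ X) :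
    (thinkMem v m).Le (X + 1) := by
  have he : v.entry m ≤ X := by
    unfold View.entry
    split
    · rename_i h; exact hl _ h
    · exact hm.2.2
  obtain ⟨h1, h2, h3⟩ := hm
  unfold thinkMem
  split
  · rename_i n hn
    obtain ⟨h4, h5, -⟩ := thinkNav_le ⟨h1, h2, h3⟩ hb hl hn
    exact ⟨by dsimp only; omega, h4, h5⟩
  · split_ifs
    · simp only [Mem.Le]; omega
    · simp only [Mem.Le]; omega

theorem decision_first {C : Config V 9} {i : Fin 9} (h : (Mem.dec (C.mem i)).clock = 0) :
    decision searchAlgorithm I C i =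
      ⟨(firstMem (view I C i)).enc,
        writeSlot (firstMem (view I C i)).grp (Nav.restart 0).slot, Action.stay⟩ :=
  if_pos h

theorem writeSlot_le {b : Board} {g : Fin 3} {x : Slot} {Y : ℕ} (hx : x.Le Y)
    (hb : ∀ g, (b g).Le Y) :
    ∃ b' : Board, writeSlot g x (Board.enc b) = Board.enc b' ∧ ∀ g, (b' g).Le Y := by
  refine ⟨_, rfl, fun g' => ?_⟩
  rw [Board.dec_enc]
  by_cases h : g' = g
  · subst h; simpa using hx
  · simpa [h] using hb g'

theorem Bounded.decision_le {C : Config V 9} {X : ℕ} (hC : Bounded C X) (i : Fin 9) :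
    (∃ m : Mem, (decision searchAlgorithm I C i).mem = m.enc ∧ m.Le (X + 1)) ∧
    ∀ b : Board, (∀ g, (b g).Le (X + 1)) →
      ∃ b' : Board, (decision searchAlgorithm I C i).edit (Board.enc b) = Board.enc b' ∧
        ∀ g, (b' g).Le (X + 1) := by
  obtain ⟨m, hm, hle⟩ := hC.mem i
  obtain ⟨b₀, hb₀, hb₀le⟩ := hC.board (C.pos i)
  have hm' : Mem.dec (C.mem i) = m := by rw [hm, Mem.dec_enc]
  have hs : (Board.dec (view I C i).board m.grp).Le X := by
    change (Board.dec (C.board (C.pos i)) m.grp).Le X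
    rw [hb₀, Board.dec_enc]
    exact hb₀le _
  have hl : ∀ q, (view I C i).last = LastMove.arrived q → q ≤ X := hC.last i
  rcases Nat.eq_zero_or_pos m.clock with h | h
  · rw [decision_first (by rwa [hm'])]
    dsimp only
    refine ⟨⟨firstMem (view I C i), rfl, ?_⟩, fun b hb => ?_⟩
    · simp [Mem.Le, firstMem]
    · exact writeSlot_le (Nav.restart_le (Nat.zero_le X)).2.2 hb
  · rcases Nat.mod_two_eq_zero_or_one m.clock with h' | h'
    · rw [decision_think (by rw [hm']; omega) (by rwa [hm']), hm']
      dsimp only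
      refine ⟨⟨thinkMem (view I C i) m, rfl, thinkMem_le hle hs hl⟩, fun b hb => ?_⟩
      unfold thinkEdit
      split
      · rename_i n hn
        exact writeSlot_le (thinkNav_le hle hs hl hn).2.2 hb
      · exact ⟨b, rfl, hb⟩
    · rw [decision_move (by rwa [hm']), hm']
      dsimp only
      refine ⟨⟨{ m with clock := m.clock + 1 }, rfl, ?_⟩, fun b hb => ⟨b, rfl, hb⟩⟩
      obtain ⟨h1, h2, h3⟩ := hle
      simp only [Mem.Le]
      omega

theorem perform_last_le [Fintype V] {P : PortGraph V} {H : SimpleGraph V} {v : V} {a : Action}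
    {q : ℕ} (h : (perform P H v a).2 = LastMove.arrived q) : q ≤ Fintype.card V := by
  cases a with
  | stay => exact absurd h (by simp [perform])
  | terminate p => exact absurd h (by simp [perform])
  | move p =>
    simp only [perform] at h
    by_cases hp : p < P.deg v
    · rw [PortGraph.traverse_eq hp] at h
      split_ifs at h
      · simp only [LastMove.arrived.injEq] at h
        rw [← h]
        exact ((PortGraph.ent_lt hp).trans (PortGraph.deg_lt _)).le
    · have hp' : ¬ p < Nat.card (P.graph.neighborSet v) := hp
      rw [traverse, dif_neg hp'] at h
      exact absurd h (by simp)

theorem Bounded.step [Fintype V] {C : Config V 9} {X t : ℕ} (hC : Bounded C X)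
    (hX : Fintype.card V ≤ X) : Bounded (step searchAlgorithm I t C) (X + 1) := by
  classical
  refine ⟨fun i => ?_, fun v => ?_, fun i q => ?_⟩
  · simp only [BHS.step]
    split_ifs
    · exact (hC.decision_le i).1
    · obtain ⟨m, hm, h1, h2, h3⟩ := hC.mem i
      exact ⟨m, hm, by omega, by omega, by omega⟩
  · simp only [BHS.step]
    generalize List.ofFn (I.order t) = l
    have h0 : ∃ b : Board, C.board v = Board.enc b ∧ ∀ g, (b g).Le (X + 1) := by
      obtain ⟨b, hb, h⟩ := hC.board v
      exact ⟨b, hb, fun g => ⟨(h g).1.trans (by omega), (h g).2.1.trans (by omega),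
        (h g).2.2.trans (by omega)⟩⟩
    revert h0
    generalize C.board v = b₀
    induction l generalizing b₀ with
    | nil => exact id
    | cons i l ih =>
      rintro ⟨b, rfl, hb⟩
      rw [List.foldl_cons]
      apply ih
      split_ifs
      · exact (hC.decision_le i).2 b hb
      · exact ⟨b, rfl, hb⟩
  · simp only [BHS.step]
    split_ifs
    · exact fun h => (perform_last_le h).trans (by omega)
    · exact fun h => (hC.last i q h).trans (by omega)

theorem bounded_run [Fintype V] (t : ℕ) :
    Bounded (run searchAlgorithm I t) (Fintype.card V + t) := by
  induction t with
  | zero =>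
    refine ⟨fun i => ⟨⟨0, 0, 0, 0, 0, false, false⟩, ?_, by simp [Mem.Le]⟩,
      fun v => ⟨fun _ => ⟨0, 0, 0⟩, ?_, by simp [Slot.Le]⟩, fun i q h => absurd h (by simp [run])⟩
    · have : (⟨0, 0, 0, 0, 0, false, false⟩ : Mem).code = 0 := by decide
      simp [run, searchAlgorithm, Mem.enc, this]
    · have : Board.code (fun _ => ⟨0, 0, 0⟩) = 0 := by decide
      simp [run, Board.enc, this]
  | succ t ih => exact ih.step (by omega)

theorem usesBitsWithin [Fintype V] {c : ℕ} (hI : I.Valid 1 c) :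
    UsesBitsWithin searchAlgorithm I (33000 * I.ports.numEdges ^ 2)
      ((2 * c + 1537) * Nat.log 2 (Fintype.card V)) := by
  intro t ht
  have hn : 1 < Fintype.card V := Fintype.one_lt_card_iff.2 ⟨_, _, hI.root_safe⟩
  have hl : 1 ≤ Nat.log 2 (Fintype.card V) := Nat.log_pos (by omega) hn
  have hE := I.ports.numEdges_le
  have hrange := hI.id_range
  have hb := bounded_run (I := I) t
  have hlt : Fintype.card V < 2 ^ (2 * Nat.log 2 (Fintype.card V)) :=
    (Nat.lt_pow_succ_log_self (by omega) _).trans_le (Nat.pow_le_pow_right (by omega) (by omega))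
  generalize Nat.log 2 (Fintype.card V) = l at *
  -- Here `t ≤ 33000|E|²` and `|E| ≤ n²`, so the left side is at most `33004 n⁴`; then `2 ^ 16`
  -- absorbs the constant.
  have hX : Fintype.card V + t + 3 ≤ 2 ^ (24 * l) := by
    have h1 : I.ports.numEdges ^ 2 ≤ Fintype.card V ^ 4 := by
      have := Nat.pow_le_pow_left hE 2
      rwa [← pow_mul] at this
    have h2 : Fintype.card V ^ 4 ≤ 2 ^ (8 * l) := by
      have := Nat.pow_le_pow_left hlt.le 4
      rwa [← pow_mul, show 2 * l * 4 = 8 * l by ring] at this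
    have h3 : Fintype.card V ≤ Fintype.card V ^ 4 := Nat.le_self_pow (by omega) _
    have h4 : 2 ^ 16 ≤ 2 ^ (16 * l) := Nat.pow_le_pow_right (by omega) (by omega)
    calc Fintype.card V + t + 3 ≤ 2 ^ 16 * Fintype.card V ^ 4 := by omega
      _ ≤ 2 ^ (16 * l) * 2 ^ (8 * l) := Nat.mul_le_mul h4 h2
      _ = 2 ^ (24 * l) := by rw [← pow_add]; congr 1; ring
  refine ⟨fun i => ?_, fun v => ?_⟩
  · obtain ⟨m, hm, hle⟩ := hb.mem i
    have h1 : ((run searchAlgorithm I t).mem i).length ≤ 24 * l * 64 := by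
      rw [hm]
      refine bits_length_le ((Mem.code_le hle).trans ?_)
      rw [pow_mul]
      exact Nat.pow_le_pow_left hX 64
    have h2 : Nat.size (I.id i) ≤ 2 * l * c + 1 := by
      refine Nat.size_le.2 ?_
      refine (hrange i).2.trans_lt ?_
      rw [pow_succ, pow_mul]
      have h3 := Nat.pow_le_pow_left hlt.le c
      have h4 : 0 < (2 ^ (2 * l)) ^ c := by positivity
      omega
    -- The memory takes `24 * 64 = 1536` bits per unit of `l`, and the identifier at most `2c + 1`,
    -- as `1 ≤ l`.
    unfold agentBits
    nlinarith
  · obtain ⟨b, hm, hle⟩ := hb.board v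
    have h1 : ((run searchAlgorithm I t).board v).length ≤ 24 * l * 16 := by
      rw [hm]
      refine bits_length_le ((Board.code_le hle).trans ?_)
      rw [pow_mul]
      exact Nat.pow_le_pow_left hX 16
    unfold nodeBits
    nlinarith [Nat.zero_le (c * l)]

end Bits

end BHS

theorem mainTheorem2 :
    ∃ (A : BHS.Algorithm) (K : ℕ), ∀ c : ℕ, ∃ M : ℕ,
      ∀ (V : Type*) [Fintype V] (I : BHS.Instance V 9), I.Valid 1 c →
        BHS.SolvesWithin A I (K * I.ports.numEdges ^ 2) ∧
        BHS.UsesBitsWithin A I (K * I.ports.numEdges ^ 2) (M * Nat.log 2 (Fintype.card V)) := by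
  exact ⟨BHS.searchAlgorithm, 33000, fun c => ⟨2 * c + 1537, fun V _ I hI =>
    ⟨BHS.solvesWithin hI le_rfl, BHS.usesBitsWithin hI⟩⟩⟩
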